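/- Let $d\ge 1$ be an integer, $\tau>0$, $h\ge\tau$, $s\in\mathbb R$, and let $C\colon[s,s+h]\times[-\tau,0]\to\mathbb R^{d\times d}$ be measurable. Set $X=L^2([-\tau,0],\mathbb R^d)$ and $X^+=L^2([0,h],\mathbb R^d)$. For $\phi\in X$ consider the renewal equation $$x(t)=\int_{-\tau}^0 C(t,\theta)\,x(t+\theta)\,d\theta\quad\text{for a.e. } t\in(s,s+h],\qquad x(s+\theta)=\phi(\theta)\quad\text{for a.e. }\theta\in[-\tau,0],$$ for $x\in L^2([s-\tau,s+h],\mathbb R^d)$, and let $T=T(s+h,s)\colon X\to X$, $(T\phi)(\theta)=x(s+h+\theta)$, be its evolution operator. For $\phi\in X$ and $w\in X^+$ let $V(\phi,w)$ be the function on $[-\tau,h]$ equal to $w$ on $(0,h]$ and to $\phi$ on $[-\tau,0]$; put $V^-\phi=V(\phi,0)$, $V^+w=V(0,w)$, and write $v_h(\theta)=v(h+\theta)$ for $\theta\in[-\tau,0]$. Let $$(\mathcal F v)(t)=\int_{-\tau}^0 C(s+t,\theta)\,v(t+\theta)\,d\theta,\qquad t\in[0,h].$$ Let $\psi_i$ be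 the Legendre polynomial of degree $i$ on $[-\tau,0]$ and, for $N\ge 1$, let $\theta_1<\dots<\theta_N$ be the zeros of the Legendre polynomial of degree $N$ on $[0,h]$, with Lagrange basis polynomials $\ell_1,\dots,\ell_N$. Define - $R_M\colon X\to(\mathbb R^d)^{M+1}$, $R_M\phi=(\phi_0,\dots,\phi_M)$, where $\phi_i=\bigl(\int_{-\tau}^0\psi_i^2\bigr)^{-1}\int_{-\tau}^0\psi_i\phi$, and $P_M\Phi=\sum_{i=0}^M\Phi_i\psi_i$ for $\Phi=(\Phi_0,\dots,\Phi_M)\in(\mathbb R^d)^{M+1}$; - $R_N^+w=(w(\theta_1),\dots,w(\theta_N))$ for $w\in H^1([0,h],\mathbb R^d)$ (through its continuous representative), and $P_N^+W=\sum_{i=1}^N\ell_iW_i$ for $W=(W_1,\dots,W_N)\in(\mathbb R^d)^N$; - $\mathbf T_{M,N}\Phi=R_M\,V(P_M\Phi,P_N^+W^*)_h$, where $W^*\in(\mathbb R^d)^N$ solves $W=R_N^+\mathcal F V(P_M\Phi,P_N^+W)$; - $T_{M,N}=P_M\mathbf T_{M,N}R_M\colon X\to X$. Assume (H1) $C\in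 L^\infty([s,s+h]\times[-\tau,0],\mathbb R^{d\times d})$; (H2) $\mathcal F V^+$ maps $X^+$ into $H^1([0,h],\mathbb R^d)$ and is bounded from $X^+$ to $H^1([0,h],\mathbb R^d)$; (H3) $\mathcal F V^-$ maps $X$ into $H^1([0,h],\mathbb R^d)$ and is bounded from $X$ to $H^1([0,h],\mathbb R^d)$. **Theorem.** For each $\phi\in X$ the initial value problem has a unique solution in $L^2([s-\tau,s+h],\mathbb R^d)$, and $T$ is a bounded linear operator on $X$. There is $N_0$ such that for all $N\ge N_0$, all $M\ge0$ and all $\Phi\in(\mathbb R^d)^{M+1}$ the equation defining $W^*$ has a unique solution, and $T_{M,N}$ is a bounded linear operator on $X$. Moreover $\|T_{M,N}-T\|_{X\leftarrow X}\to0$ as $N\to\infty$ with $M\ge N-1$, that is, for every $\varepsilon>0$ there is $N_1$ such that $\|T_{M,N}-T\|_{X\leftarrow X}<\varepsilon$ for all $N\ge N_1$ and all $M\ge N-1$. -/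

import Mathlib

open MeasureTheory Set Filter Topology

noncomputable section

namespace RenewalEq

/-- `ℝ^d` with the Euclidean norm. -/
abbrev E (d : ℕ) : Type := EuclideanSpace ℝ (Fin d)

/-- `L²([a,b], ℝ^d)`. The state space is `X = L2 d (-τ) 0`, and `X⁺ = L2 d 0 h`. -/
abbrev L2 (d : ℕ) (a b : ℝ) : Type := Lp (E d) 2 (volume.restrict (Icc a b))

/-! ### The renewal equation and its evolution operators -/

/-- `∫_{-τ}^0 C(t,θ) x(t+θ) dθ`, the right-hand side of the renewal equation at time `t`. -/
def renewalRHS {d : ℕ} (C : ℝ → ℝ → Matrix (Fin d) (Fin d) ℝ) (τ t : ℝ) (x : ℝ → E d) : E d :=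
  ∫ θ in Icc (-τ) 0, Matrix.toEuclideanLin (C t θ) (x (t + θ))

/-- The kernel `C` belongs to `L^∞([a,b] × [-τ,0], ℝ^{d×d})`. -/
def KernelLInfty {d : ℕ} (C : ℝ → ℝ → Matrix (Fin d) (Fin d) ℝ) (τ a b : ℝ) : Prop :=
  ∀ i j, MemLp (fun p : ℝ × ℝ => C p.1 p.2 i j) ⊤
    (volume.restrict (Icc a b ×ˢ Icc (-τ) 0))

/-- `x` is an `L²` solution on `[s-τ, t]` of the initial value problem
`x(r) = ∫_{-τ}^0 C(r,θ) x(r+θ) dθ` for (almost every) `r ∈ (s,t]`, with `x_s = φ`. -/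
structure IsSolution {d : ℕ} (C : ℝ → ℝ → Matrix (Fin d) (Fin d) ℝ) (τ s t : ℝ)
    (φ : L2 d (-τ) 0) (x : ℝ → E d) : Prop where
  memLp : MemLp x 2 (volume.restrict (Icc (s - τ) t))
  initial : ∀ᵐ θ ∂(volume.restrict (Icc (-τ) 0)), x (s + θ) = φ θ
  equation : ∀ᵐ r ∂(volume.restrict (Ioc s t)), x r = renewalRHS C τ r x

/-- The evolution operator `T(t,s) : X → X`, `T(t,s) φ = x_t(· ; s, φ)`: the element `ψ` of `X`
with `ψ(θ) = x(t+θ)`, where `x` is the solution of the initial value problem. -/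
def evolution {d : ℕ} (C : ℝ → ℝ → Matrix (Fin d) (Fin d) ℝ) (τ t s : ℝ)
    (φ : L2 d (-τ) 0) : L2 d (-τ) 0 :=
  Classical.epsilon fun ψ => ∃ x, IsSolution C τ s t φ x ∧
    ∀ᵐ θ ∂(volume.restrict (Icc (-τ) 0)), ψ θ = x (t + θ)

/-! ### The operators `V` and `𝓕` -/

/-- `V(φ,w)` is `w` on `(0,h]` and `φ` on `[-τ,0]`. -/
def V {d : ℕ} (φ w : ℝ → E d) : ℝ → E d := fun t => if 0 < t then w t else φ t

/-- `(𝓕 v)(t) = ∫_{-τ}^0 C(s+t,θ) v(t+θ) dθ`. -/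
def F {d : ℕ} (C : ℝ → ℝ → Matrix (Fin d) (Fin d) ℝ) (τ s : ℝ) (v : ℝ → E d) : ℝ → E d :=
  fun t => ∫ θ in Icc (-τ) 0, Matrix.toEuclideanLin (C (s + t) θ) (v (t + θ))

/-- `𝓕 V⁺ w = 𝓕 V(0,w)` for `w ∈ X⁺`. -/
def FVplus {d : ℕ} (C : ℝ → ℝ → Matrix (Fin d) (Fin d) ℝ) (τ s h : ℝ)
    (w : L2 d 0 h) : ℝ → E d :=
  F C τ s (V 0 w)

/-- `𝓕 V⁻ φ = 𝓕 V(φ,0)` for `φ ∈ X`. -/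
def FVminus {d : ℕ} (C : ℝ → ℝ → Matrix (Fin d) (Fin d) ℝ) (τ s : ℝ)
    (φ : L2 d (-τ) 0) : ℝ → E d :=
  F C τ s (V φ 0)

/-! ### The Sobolev space `H¹([0,h], ℝ^d)` -/

/-- `g ∈ L²([0,h], ℝ^d)` is the weak derivative of `f` on `(0,h)`. -/
def HasWeakDeriv {d : ℕ} (h : ℝ) (f g : ℝ → E d) : Prop :=
  MemLp g 2 (volume.restrict (Icc 0 h)) ∧
    ∀ η : ℝ → ℝ, ContDiff ℝ 1 η → HasCompactSupport η → tsupport η ⊆ Ioo 0 h →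
      ∫ t in Icc 0 h, deriv η t • f t = - ∫ t in Icc 0 h, η t • g t

/-- `f ∈ H¹([0,h], ℝ^d)` (up to modification on a null set). -/
def MemH1 {d : ℕ} (h : ℝ) (f : ℝ → E d) : Prop :=
  MemLp f 2 (volume.restrict (Icc 0 h)) ∧ ∃ g, HasWeakDeriv h f g

/-- The (almost everywhere unique) weak derivative. -/
def weakDeriv {d : ℕ} (h : ℝ) (f : ℝ → E d) : ℝ → E d :=
  Classical.epsilon fun g => HasWeakDeriv h f g

/-- The norm of `H¹([0,h], ℝ^d)`: the square root of `‖f‖² + ‖f'‖²` (norms in `L²`). -/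
def h1Norm {d : ℕ} (h : ℝ) (f : ℝ → E d) : ℝ :=
  Real.sqrt ((∫ t in Icc 0 h, ‖f t‖ ^ 2) + ∫ t in Icc 0 h, ‖weakDeriv h f t‖ ^ 2)

/-- The map `A` has range contained in `H¹([0,h], ℝ^d)` and is bounded into this space. -/
def BoundedIntoH1 {d : ℕ} {Y : Type*} [NormedAddCommGroup Y] (h : ℝ) (A : Y → ℝ → E d) : Prop :=
  (∀ y, MemH1 h (A y)) ∧ ∃ c : ℝ, ∀ y, h1Norm h (A y) ≤ c * ‖y‖

/-- The continuous representative on `[0,h]` of (the class of) an `H¹` function. -/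
def contRep {d : ℕ} (h : ℝ) (f : ℝ → E d) : ℝ → E d :=
  Classical.epsilon fun g => ContinuousOn g (Icc 0 h) ∧ g =ᵐ[volume.restrict (Icc 0 h)] f

/-! ### Legendre polynomials, restriction and prolongation operators -/

/-- The Legendre polynomial of degree `n` on `[a,b]`, normalised to be `1` at `b`. Mathlib's
`Polynomial.shiftedLegendre n` is `x ↦ P_n (1 - 2x)`, with `P_n` the classical polynomial on
`[-1,1]`; here `x = (b - t) / (b - a)`. -/
def legendre (a b : ℝ) (n : ℕ) : Polynomial ℝ :=
  ((Polynomial.shiftedLegendre n).map (Int.castRingHom ℝ)).comp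
    (Polynomial.C ((b - a)⁻¹) * (Polynomial.C b - Polynomial.X))

/-- The collocation nodes: the zeros of the Legendre polynomial of degree `N` on `[0,h]`. -/
def nodes (h : ℝ) (N : ℕ) : Finset ℝ := (legendre 0 h N).roots.toFinset

/-- The coefficient `φ_i` of the Legendre series of `φ` on `[-τ,0]`. -/
def legendreCoeff {d : ℕ} (τ : ℝ) (φ : ℝ → E d) (i : ℕ) : E d :=
  (∫ t in Icc (-τ) 0, (legendre (-τ) 0 i).eval t ^ 2)⁻¹ •
    ∫ t in Icc (-τ) 0, (legendre (-τ) 0 i).eval t • φ t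

/-- The restriction `R_M : X → X_M = (ℝ^d)^(M+1)`. -/
def R {d : ℕ} (τ : ℝ) (M : ℕ) (φ : ℝ → E d) : Fin (M + 1) → E d :=
  fun i => legendreCoeff τ φ i

/-- The prolongation `P_M : X_M → X`, as a function. -/
def P {d : ℕ} (τ : ℝ) (M : ℕ) (Φ : Fin (M + 1) → E d) : ℝ → E d :=
  fun t => ∑ i : Fin (M + 1), (legendre (-τ) 0 (i : ℕ)).eval t • Φ i

theorem memLp_P {d : ℕ} (τ : ℝ) (M : ℕ) (Φ : Fin (M + 1) → E d) :
    MemLp (P τ M Φ) 2 (volume.restrict (Icc (-τ) 0)) := by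
  have hc : Continuous (P τ M Φ) := by
    unfold P
    exact continuous_finsetSum _ fun i _ => (Polynomial.continuous _).smul continuous_const
  obtain ⟨K, hK⟩ := (isCompact_Icc (a := -τ) (b := 0)).exists_bound_of_continuousOn hc.continuousOn
  refine MemLp.of_bound hc.aestronglyMeasurable K ?_
  filter_upwards [ae_restrict_mem measurableSet_Icc] with t ht using hK t ht

/-- The restriction `R_N⁺`, by values at the nodes. Elements of `X_N⁺ = (ℝ^d)^N` are indexed by the
nodes themselves. -/
def Rplus {d : ℕ} (h : ℝ) (N : ℕ) (w : ℝ → E d) : nodes h N → E d :=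
  fun x => contRep h w x

/-- The prolongation `P_N⁺`, by Lagrange interpolation at the nodes. -/
def Pplus {d : ℕ} (h : ℝ) (N : ℕ) (W : nodes h N → E d) : ℝ → E d :=
  fun t => ∑ x : nodes h N, (Lagrange.basis (nodes h N) id (x : ℝ)).eval t • W x

/-! ### The discretized evolution operators -/

/-- The discrete fixed point equation `W = R_N⁺ 𝓕 V(P_M Φ, P_N⁺ W)`. -/
def IsDiscreteFixedPoint {d : ℕ} (C : ℝ → ℝ → Matrix (Fin d) (Fin d) ℝ) (τ s h : ℝ) (M N : ℕ)
    (Φ : Fin (M + 1) → E d) (W : nodes h N → E d) : Prop :=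
  W = Rplus h N (F C τ s (V (P τ M Φ) (Pplus h N W)))

/-- The finite-dimensional operator `𝐓_{M,N} : X_M → X_M`,
`𝐓_{M,N} Φ = R_M (V(P_M Φ, P_N⁺ W*)_h)`, with `W*` the solution of the discrete fixed point
equation. -/
def discreteEvolution {d : ℕ} (C : ℝ → ℝ → Matrix (Fin d) (Fin d) ℝ) (τ s h : ℝ) (M N : ℕ)
    (Φ : Fin (M + 1) → E d) : Fin (M + 1) → E d :=
  R τ M fun θ => V (P τ M Φ)
    (Pplus h N (Classical.epsilon fun W => IsDiscreteFixedPoint C τ s h M N Φ W)) (h + θ)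

/-- The finite-rank operator `T_{M,N} = P_M 𝐓_{M,N} R_M : X → X`. -/
def approxEvolution {d : ℕ} (C : ℝ → ℝ → Matrix (Fin d) (Fin d) ℝ) (τ s h : ℝ) (M N : ℕ)
    (φ : L2 d (-τ) 0) : L2 d (-τ) 0 :=
  (memLp_P τ M (discreteEvolution C τ s h M N (R τ M φ))).toLp _

end RenewalEq

end

noncomputable section

namespace RenewalEq


/-! ### Legendre polynomials -/

section Legendre

open Polynomial

/-! After shifting time by $s$, a solution is determined by its part $w$ on $[0,h]$, and the problem
reads $w = \mathcal F V^+ w + \mathcal F V^-\varphi$ in $L^2([0,h])$. The operator $\mathcal F V^+$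
is of Volterra type with bounded kernel, so its powers decay factorially and $1-\mathcal F V^+$ is
invertible (`isUnit_one_sub_volterra`). As $\tau\le h$, the final segment sees only $w$; hence $T =
S(1-\mathcal F V^+)^{-1}\mathcal F V^-$ with $S$ the segment map.

Write $\Pi_M=P_MR_M$ for the orthogonal projection and $I_N=P_N^+R_N^+$ for interpolation. When the
inverse exists, $T_{M,N} = \Pi_M S(1-I_N\mathcal F V^+)^{-1}I_N\mathcal F V^-\Pi_M$
(`approxOp_apply`). Three facts give norm convergence.

First, $I_N\mathcal F V^\pm\to\mathcal F V^\pm$ in operator norm (`tendsto_interpOp`). The Lagrange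
polynomials at the Legendre zeros are mutually orthogonal by Gauss quadrature, so interpolation is
bounded from the sup norm to $L^2$ by $\sqrt h$ for every $N$. Its error is then controlled by best
uniform approximation, which Bernstein polynomials bound uniformly over functions with a common
Hölder-$1/2$ constant, and $H^1$ bounds supply such a constant. Invertibility is an open condition
and inversion is continuous, so the discrete resolvents exist for large $N$ and converge.

Second, $\mathcal F V^-\Pi_M\to\mathcal F V^-$ in norm (`tendsto_h1Op_comp_projOp`), although
$\Pi_M\to1$ only strongly: $\mathcal F V^-$ is a norm limit of finite-rank operators, and $\Pi_M$ is
self-adjoint.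

Third, the discrete solution has degree below $N\le M+1$, so the outer $\Pi_M$ acts as the identity
on its segment (`approxOp_eq`). -/

theorem intervalIntegrable_eval (p : ℝ[X]) (a b : ℝ) :
    IntervalIntegrable (fun t => p.eval t) volume a b :=
  p.continuous.intervalIntegrable a b

/-- Repeated integration by parts for polynomials whose derivatives vanish at both ends. -/
theorem integral_iterate_derivative_mul (a b : ℝ) (f : ℝ[X]) (n : ℕ) :
    ∀ q : ℝ[X], (∀ k < n, (derivative^[k] f).eval a = 0 ∧ (derivative^[k] f).eval b = 0) →
    ∫ t in a..b, (derivative^[n] f).eval t * q.eval t =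
      (-1) ^ n * ∫ t in a..b, f.eval t * (derivative^[n] q).eval t := by
  induction n with
  | zero => intro q _; simp
  | succ n ih =>
    intro q hf
    have h1 : ∫ t in a..b, (derivative^[n + 1] f).eval t * q.eval t =
        - ∫ t in a..b, (derivative^[n] f).eval t * (derivative q).eval t := by
      have := intervalIntegral.integral_deriv_mul_eq_sub_of_hasDeriv_right (a := a) (b := b)
        (u := fun t => (derivative^[n] f).eval t) (v := fun t => q.eval t)
        (u' := fun t => (derivative^[n + 1] f).eval t) (v' := fun t => (derivative q).eval t)
        (Polynomial.continuous _).continuousOn (Polynomial.continuous _).continuousOn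
        (fun x _ => by
          rw [Function.iterate_succ_apply']
          exact (Polynomial.hasDerivAt _ x).hasDerivWithinAt)
        (fun x _ => (Polynomial.hasDerivAt _ x).hasDerivWithinAt)
        (intervalIntegrable_eval _ _ _) (intervalIntegrable_eval _ _ _)
      rw [(hf n n.lt_succ_self).1, (hf n n.lt_succ_self).2, intervalIntegral.integral_add] at this
      · linarith
      · simpa only [eval_mul] using intervalIntegrable_eval ((derivative^[n + 1] f) * q) a b
      · simpa only [eval_mul] using intervalIntegrable_eval ((derivative^[n] f) * derivative q) a b
    rw [h1, ih _ fun k hk => hf k (hk.trans n.lt_succ_self), Function.iterate_succ_apply]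
    ring

/-- By Rodrigues' formula, $n!$ times the polynomial is the $n$-th derivative of $X^n(1-X)^n$, whose
lower derivatives vanish at both ends. Integrating by parts $n$ times moves every derivative onto
`q`, which they annihilate. -/
theorem integral_shiftedLegendre_mul {n : ℕ} {q : ℝ[X]} (hq : q.degree < n) :
    ∫ t in (0 : ℝ)..1,
      ((shiftedLegendre n).map (Int.castRingHom ℝ)).eval t * q.eval t = 0 := by
  have hR : (n.factorial : ℝ[X]) * (shiftedLegendre n).map (Int.castRingHom ℝ) =
      derivative^[n] (X ^ n * (1 - X) ^ n) := by
    have := congrArg (Polynomial.map (Int.castRingHom ℝ)) (factorial_mul_shiftedLegendre_eq n)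
    rw [← iterate_derivative_map] at this
    simpa using this
  have hz : ∀ k < n, (derivative^[k] ((X : ℝ[X]) ^ n * (1 - X) ^ n)).eval 0 = 0 ∧
      (derivative^[k] ((X : ℝ[X]) ^ n * (1 - X) ^ n)).eval 1 = 0 := by
    intro k hk
    have h1 : (X * (1 - X) : ℝ[X]) ^ (n - k) ∣ derivative^[k] ((X : ℝ[X]) ^ n * (1 - X) ^ n) := by
      rw [← mul_pow]
      exact pow_sub_dvd_iterate_derivative_pow _ _ _
    have hk' : n - k ≠ 0 := by omega
    obtain ⟨g, hg⟩ := h1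
    rw [hg]
    simp [hk']
  have h := integral_iterate_derivative_mul 0 1 _ n q hz
  rw [← hR, iterate_derivative_eq_zero_of_degree_lt hq] at h
  simp only [eval_mul, eval_natCast, eval_zero, mul_zero, intervalIntegral.integral_zero,
    mul_assoc, intervalIntegral.integral_const_mul] at h
  exact (mul_eq_zero.1 h).resolve_left (by positivity)

theorem natDegree_affine {a b : ℝ} (hab : a < b) :
    (C ((b - a)⁻¹) * (C b - X) : ℝ[X]).natDegree = 1 := by
  rw [natDegree_C_mul (inv_ne_zero (sub_pos.2 hab).ne'), ← natDegree_neg, neg_sub,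
    natDegree_X_sub_C]

theorem natDegree_legendre {a b : ℝ} (hab : a < b) (n : ℕ) : (legendre a b n).natDegree = n := by
  rw [legendre, natDegree_comp, natDegree_affine hab, mul_one,
    natDegree_map_eq_of_injective (RingHom.injective_int _), natDegree_shiftedLegendre]

theorem legendre_ne_zero {a b : ℝ} (hab : a < b) (n : ℕ) : legendre a b n ≠ 0 := by
  rcases Nat.eq_zero_or_pos n with rfl | hn
  · simp [legendre, shiftedLegendre]
  · intro h
    have := natDegree_legendre hab n
    rw [h, natDegree_zero] at this
    omega

theorem degree_legendre {a b : ℝ} (hab : a < b) (n : ℕ) : (legendre a b n).degree = n := by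
  rw [degree_eq_natDegree (legendre_ne_zero hab n), natDegree_legendre hab]

/-- The Legendre polynomial of degree `n` is orthogonal to all polynomials of lower degree. -/
theorem integral_legendre_mul {a b : ℝ} (hab : a < b) {n : ℕ} {q : ℝ[X]} (hq : q.degree < n) :
    ∫ t in a..b, (legendre a b n).eval t * q.eval t = 0 := by
  have hba : b - a ≠ 0 := (sub_pos.2 hab).ne'
  -- The pullback of `q` under the inverse of the affine substitution in `legendre`, which reduces
  -- the claim to $[0,1]$.
  set q' : ℝ[X] := q.comp (C b - C (b - a) * X) with hq'
  have hdeg : q'.degree < n := by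
    rcases eq_or_ne q 0 with rfl | h0
    · simp [hq']
    · refine lt_of_le_of_lt (degree_le_natDegree.trans ?_) hq
      rw [degree_eq_natDegree h0, hq']
      norm_cast
      refine natDegree_comp_le.trans ?_
      have : (C b - C (b - a) * X : ℝ[X]).natDegree ≤ 1 := by
        refine (natDegree_sub_le _ _).trans (max_le (by simp) ((natDegree_C_mul_le _ _).trans (by simp)))
      nlinarith
  have h := integral_shiftedLegendre_mul hdeg
  have hsub := intervalIntegral.integral_comp_sub_mul (a := a) (b := b)
    (fun x => ((shiftedLegendre n).map (Int.castRingHom ℝ)).eval x * q'.eval x)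
    (inv_ne_zero hba) (b * (b - a)⁻¹)
  have e0 : b * (b - a)⁻¹ - (b - a)⁻¹ * b = 0 := by ring
  have e1 : b * (b - a)⁻¹ - (b - a)⁻¹ * a = 1 := by field_simp
  rw [e0, e1, h, smul_zero] at hsub
  rw [← hsub]
  refine intervalIntegral.integral_congr fun t _ => ?_
  have e2 : b - (b - a) * (b * (b - a)⁻¹ - (b - a)⁻¹ * t) = t := by field_simp; ring
  have e3 : (b - a)⁻¹ * (b - t) = b * (b - a)⁻¹ - (b - a)⁻¹ * t := by ring
  simp only [legendre, hq', eval_comp, eval_mul, eval_sub, eval_C, eval_X, e2, e3]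

theorem integral_eval_pos {a b : ℝ} (hab : a < b) {p : ℝ[X]} (hp : p ≠ 0)
    (h0 : ∀ t ∈ Icc a b, 0 ≤ p.eval t) : 0 < ∫ t in a..b, p.eval t := by
  refine intervalIntegral.integral_pos hab p.continuous.continuousOn
    (fun t ht => h0 t (Ioc_subset_Icc_self ht)) ?_
  by_contra! hcon
  refine hp (eq_zero_of_infinite_isRoot _ ((Icc_infinite hab).mono fun t ht => ?_))
  exact le_antisymm (hcon t ht) (h0 t ht)

/-- A Legendre polynomial has no divisor of positive degree that does not change sign. -/
theorem not_legendre_eq_mul {a b : ℝ} (hab : a < b) {n : ℕ} {g q : ℝ[X]}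
    (hg : 0 < g.natDegree) (h0 : ∀ t ∈ Icc a b, 0 ≤ g.eval t) : legendre a b n ≠ g * q := by
  intro h
  have hne := legendre_ne_zero hab n
  rw [h] at hne
  have hq0 := right_ne_zero_of_mul hne
  have hg0 := left_ne_zero_of_mul hne
  have hd : q.degree < n := by
    rw [degree_eq_natDegree hq0]
    have := natDegree_legendre hab n
    rw [h, natDegree_mul hg0 hq0] at this
    norm_cast
    omega
  have h1 := integral_legendre_mul hab hd
  -- The product of the Legendre polynomial with the cofactor `q` is $gq^2\ge0$ on the interval, so
  -- its integral is positive, against orthogonality to the lower-degree `q`.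
  have h2 := integral_eval_pos hab (p := g * q * q) (mul_ne_zero hne hq0) fun t ht => by
    rw [eval_mul, eval_mul, mul_assoc]
    exact mul_nonneg (h0 t ht) (mul_self_nonneg _)
  rw [h] at h1
  simp only [eval_mul] at h1 h2
  exact h2.ne' h1

/-- A nonreal root $z$ would contribute the real quadratic factor $|t-z|^2$, which never changes
sign. -/
theorem splits_legendre {a b : ℝ} (hab : a < b) (n : ℕ) : (legendre a b n).Splits := by
  refine Splits.of_splits_map (algebraMap ℝ ℂ) (IsAlgClosed.splits _) fun z hz => ?_
  have hz' : aeval z (legendre a b n) = 0 := by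
    rw [mem_roots', IsRoot, eval_map_algebraMap] at hz
    exact hz.2
  by_cases him : z.im = 0
  · exact ⟨z.re, Complex.ext rfl him.symm⟩
  · exfalso
    obtain ⟨q, hq⟩ := quadratic_dvd_of_aeval_eq_zero_im_ne_zero _ hz' him
    refine not_legendre_eq_mul hab ?_ ?_ hq
    · have : (X ^ 2 - C (2 * z.re) * X + C (‖z‖ ^ 2) : ℝ[X]).natDegree = 2 := by
        compute_degree!
      omega
    · intro t _
      have : ‖z‖ ^ 2 = z.re ^ 2 + z.im ^ 2 := by
        rw [Complex.sq_norm, Complex.normSq_apply]; ring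
      simp only [eval_add, eval_sub, eval_pow, eval_mul, eval_C, eval_X, this]
      nlinarith [sq_nonneg (t - z.re), sq_nonneg z.im]

/-- A multiple root $r$ would contribute the nonnegative factor $(t-r)^2$. -/
theorem nodup_roots_legendre {a b : ℝ} (hab : a < b) (n : ℕ) : (legendre a b n).roots.Nodup := by
  rw [Multiset.nodup_iff_count_le_one]
  intro r
  rw [count_roots]
  by_contra! hcon
  obtain ⟨q, hq⟩ := (le_rootMultiplicity_iff (legendre_ne_zero hab n)).1 hcon
  refine not_legendre_eq_mul hab (g := (X - C r) ^ 2) ?_ (fun t _ => ?_) hq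
  · simp
  · simp only [eval_pow]; positivity

/-- A root outside the open interval would give a linear factor of constant sign on $[a,b]$. -/
theorem root_legendre_mem {a b : ℝ} (hab : a < b) {n : ℕ} {r : ℝ}
    (hr : (legendre a b n).IsRoot r) : r ∈ Ioo a b := by
  obtain ⟨q, hq⟩ := dvd_iff_isRoot.2 hr
  refine ⟨?_, ?_⟩ <;> by_contra! hcon
  · refine not_legendre_eq_mul hab (g := X - C r) (by simp) (fun t ht => ?_) hq
    simp only [eval_sub, eval_X, eval_C]
    linarith [ht.1]
  · refine not_legendre_eq_mul hab (g := C r - X) (q := -q) ?_ (fun t ht => ?_) (by rw [hq]; ring)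
    · rw [← natDegree_neg]; simp
    · simp only [eval_sub, eval_X, eval_C]
      linarith [ht.2]

theorem card_nodes {h : ℝ} (hh : 0 < h) (N : ℕ) : (nodes h N).card = N := by
  rw [nodes, Multiset.toFinset_card_of_nodup (nodup_roots_legendre hh N),
    ← (splits_legendre hh N).natDegree_eq_card_roots, natDegree_legendre hh]

theorem nodes_subset {h : ℝ} (hh : 0 < h) {N : ℕ} {x : ℝ} (hx : x ∈ nodes h N) : x ∈ Ioo 0 h := by
  rw [nodes, Multiset.mem_toFinset, mem_roots'] at hx
  exact root_legendre_mem hh hx.2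

theorem legendre_dvd {h : ℝ} (hh : 0 < h) {N : ℕ} {p : ℝ[X]}
    (hp : ∀ x ∈ nodes h N, p.IsRoot x) : legendre 0 h N ∣ p := by
  rcases eq_or_ne p 0 with rfl | hp0
  · exact dvd_zero _
  · refine (splits_legendre hh N).dvd_of_roots_le_roots (legendre_ne_zero hh N) ?_
    refine (Multiset.le_iff_subset (nodup_roots_legendre hh N)).2 fun x hx => ?_
    exact (mem_roots hp0).2 (hp x (Multiset.mem_toFinset.2 hx))

/-- Gauss quadrature exactness: such a `p` is the Legendre polynomial times a cofactor of degree
below `N`, to which it is orthogonal. -/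
theorem integral_mul_eq_zero_of_isRoot {h : ℝ} (hh : 0 < h) {N : ℕ} {p : ℝ[X]}
    (hp : ∀ x ∈ nodes h N, p.IsRoot x) (hd : p.natDegree < 2 * N) :
    ∫ t in 0..h, p.eval t = 0 := by
  obtain ⟨q, rfl⟩ := legendre_dvd hh hp
  rcases eq_or_ne q 0 with rfl | hq
  · simp
  · rw [natDegree_mul (legendre_ne_zero hh N) hq, natDegree_legendre hh] at hd
    simp only [eval_mul]
    refine integral_legendre_mul hh ?_
    rw [degree_eq_natDegree hq]
    norm_cast
    omega

end Legendre


/-! ### Vector-valued polynomials -/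

section VectorPolynomial

open Polynomial

variable {d : ℕ}

/-- The `ℝ^d`-valued polynomial functions of degree less than `n`. -/
def vpoly (d n : ℕ) : Submodule ℝ (ℝ → E d) :=
  Submodule.span ℝ {g | ∃ (p : ℝ[X]) (v : E d), p.degree < n ∧ g = fun t => p.eval t • v}

theorem smul_mem_vpoly {n : ℕ} {p : ℝ[X]} (hp : p.degree < n) (v : E d) :
    (fun t => p.eval t • v) ∈ vpoly d n :=
  Submodule.subset_span ⟨p, v, hp, rfl⟩

theorem sum_smul_mem_vpoly {n : ℕ} {ι : Type*} (s : Finset ι) {p : ι → ℝ[X]}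
    (hp : ∀ i ∈ s, (p i).degree < n) (v : ι → E d) :
    (fun t => ∑ i ∈ s, (p i).eval t • v i) ∈ vpoly d n := by
  have : (fun t => ∑ i ∈ s, (p i).eval t • v i) = ∑ i ∈ s, fun t => (p i).eval t • v i := by
    ext1 t; simp
  rw [this]
  exact Submodule.sum_mem _ fun i hi => smul_mem_vpoly (hp i hi) _

theorem vpoly_mono {m n : ℕ} (h : m ≤ n) : vpoly d m ≤ vpoly d n := by
  refine Submodule.span_mono ?_
  rintro _ ⟨p, v, hp, rfl⟩
  exact ⟨p, v, hp.trans_le (by exact_mod_cast h), rfl⟩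

theorem continuous_of_mem_vpoly {n : ℕ} {f : ℝ → E d} (hf : f ∈ vpoly d n) : Continuous f := by
  induction hf using Submodule.span_induction with
  | mem x hx =>
    obtain ⟨p, v, -, rfl⟩ := hx
    exact p.continuous.smul continuous_const
  | zero => exact continuous_const
  | add x y _ _ hx hy => exact hx.add hy
  | smul c x _ hx => exact hx.const_smul c

theorem comp_add_mem_vpoly {n : ℕ} {f : ℝ → E d} (hf : f ∈ vpoly d n) (c : ℝ) :
    (fun t => f (c + t)) ∈ vpoly d n := by
  induction hf using Submodule.span_induction with
  | mem x hx =>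
    obtain ⟨p, v, hp, rfl⟩ := hx
    have : (fun t => p.eval (c + t) • v) = fun t => (p.comp (X + Polynomial.C c)).eval t • v := by
      ext1 t; simp [add_comm]
    rw [this]
    refine smul_mem_vpoly ?_ v
    rcases eq_or_ne p 0 with rfl | h0
    · simp
    · rw [degree_eq_natDegree h0] at hp
      refine degree_le_natDegree.trans_lt ?_
      rw [natDegree_comp, natDegree_X_add_C, mul_one]
      exact hp
  | zero => exact Submodule.zero_mem _
  | add x y _ _ hx hy => exact Submodule.add_mem _ hx hy
  | smul a x _ hx => exact Submodule.smul_mem _ a hx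

theorem eval_bernsteinPolynomial_nonneg (n k : ℕ) {x : ℝ} (hx : x ∈ Icc (0 : ℝ) 1) :
    0 ≤ (bernsteinPolynomial ℝ n k).eval x := by
  have h1 : 0 ≤ 1 - x := by linarith [hx.2]
  have h0 := hx.1
  simp only [bernsteinPolynomial, eval_mul, eval_natCast, eval_pow, eval_X, eval_sub, eval_one]
  positivity

theorem degree_bernsteinPolynomial_comp_lt {n k : ℕ} (hk : k < n + 1) {q : ℝ[X]}
    (hq : q.natDegree ≤ 1) :
    ((bernsteinPolynomial ℝ n k).comp q).degree < ((n + 1 : ℕ) : WithBot ℕ) := by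
  refine degree_le_natDegree.trans_lt ?_
  norm_cast
  have h1 : (bernsteinPolynomial ℝ n k).natDegree ≤ n := by
    unfold bernsteinPolynomial
    have h2 : (1 - X : ℝ[X]).natDegree ≤ 1 := (natDegree_sub_le _ _).trans (by simp)
    refine natDegree_mul_le.trans ?_
    have h3 : ((n.choose k : ℝ[X]) * X ^ k).natDegree ≤ k := by
      refine natDegree_mul_le.trans ?_
      simp
    have h4 : ((1 - X : ℝ[X]) ^ (n - k)).natDegree ≤ n - k :=
      natDegree_pow_le.trans (by nlinarith)
    omega
  have h5 := natDegree_comp_le (p := bernsteinPolynomial ℝ n k) (q := q)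
  nlinarith

/-- Bernstein approximation on `[a,b]` of a function with a quadratic majorant of its modulus of
continuity. -/
theorem exists_vpoly_approx {a b : ℝ} (hab : a < b) {n : ℕ} (hn : 0 < n) {f : ℝ → E d} {α β : ℝ}
    (hβ : 0 ≤ β)
    (hf : ∀ x ∈ Icc a b, ∀ y ∈ Icc a b, ‖f x - f y‖ ≤ α + β * (x - y) ^ 2) :
    ∃ p ∈ vpoly d (n + 1), ∀ t ∈ Icc a b, ‖f t - p t‖ ≤ α + β * (b - a) ^ 2 / n := by
  have hba : 0 < b - a := sub_pos.2 hab
  have hn' : (0 : ℝ) < n := by exact_mod_cast hn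
  set q : ℝ[X] := Polynomial.C ((b - a)⁻¹) * (X - Polynomial.C a) with hq
  have hqd : q.natDegree ≤ 1 := (natDegree_C_mul_le _ _).trans (by simp)
  refine ⟨fun t => ∑ k ∈ Finset.range (n + 1), ((bernsteinPolynomial ℝ n k).comp q).eval t •
      f (a + (b - a) * (k / n)), sum_smul_mem_vpoly _ (fun k hk =>
        degree_bernsteinPolynomial_comp_lt (Finset.mem_range.1 hk) hqd) _, fun t ht => ?_⟩
  set x : ℝ := (b - a)⁻¹ * (t - a) with hx
  have hqt : q.eval t = x := by simp [hq, hx]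
  have hxt : (b - a) * x = t - a := by rw [hx]; field_simp
  have hx01 : x ∈ Icc (0 : ℝ) 1 := by
    refine ⟨mul_nonneg (inv_nonneg.2 hba.le) (by linarith [ht.1]), ?_⟩
    rw [hx, inv_mul_le_iff₀ hba]; linarith [ht.2]
  have hsum : ∑ k ∈ Finset.range (n + 1), (bernsteinPolynomial ℝ n k).eval x = 1 := by
    have := congrArg (eval x) (bernsteinPolynomial.sum ℝ n)
    simpa [eval_finsetSum] using this
  have hvar : ∑ k ∈ Finset.range (n + 1), (n * x - k) ^ 2 * (bernsteinPolynomial ℝ n k).eval x =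
      n * x * (1 - x) := by
    have := congrArg (eval x) (bernsteinPolynomial.variance ℝ n)
    simpa [eval_finsetSum] using this
  simp only [eval_comp, hqt]
  have h1 : f t - ∑ k ∈ Finset.range (n + 1), (bernsteinPolynomial ℝ n k).eval x •
      f (a + (b - a) * (k / n)) = ∑ k ∈ Finset.range (n + 1), (bernsteinPolynomial ℝ n k).eval x •
      (f t - f (a + (b - a) * (k / n))) := by
    simp only [smul_sub, Finset.sum_sub_distrib, ← Finset.sum_smul, hsum, one_smul]
  rw [h1]
  -- The Bernstein weights form a probability distribution, and a quadratic majorant averages to a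
  -- multiple of its variance, $x(1-x)/n$ after rescaling. This gives an explicit rate with no
  -- splitting of the sum.
  calc _ ≤ ∑ k ∈ Finset.range (n + 1), (bernsteinPolynomial ℝ n k).eval x *
        (α + β * (b - a) ^ 2 / n ^ 2 * (n * x - k) ^ 2) := by
        refine (norm_sum_le _ _).trans (Finset.sum_le_sum fun k hk => ?_)
        have hb := eval_bernsteinPolynomial_nonneg n k hx01
        rw [norm_smul, Real.norm_of_nonneg hb]
        refine mul_le_mul_of_nonneg_left ?_ hb
        have hk' : (k : ℝ) / n ∈ Icc (0 : ℝ) 1 := by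
          refine ⟨by positivity, (div_le_one hn').2 ?_⟩
          exact_mod_cast Nat.lt_succ_iff.1 (Finset.mem_range.1 hk)
        refine (hf t ht _ ⟨by nlinarith [hk'.1], by nlinarith [hk'.2]⟩).trans (le_of_eq ?_)
        have : t - (a + (b - a) * (k / n)) = (b - a) / n * (n * x - k) := by
          field_simp
          nlinarith [hxt]
        rw [this]
        ring
    _ = α + β * (b - a) ^ 2 / n ^ 2 * (n * x * (1 - x)) := by
        rw [← hvar, Finset.mul_sum]
        simp only [mul_add, Finset.sum_add_distrib]
        rw [← Finset.sum_mul, hsum, one_mul]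
        congr 1
        exact Finset.sum_congr rfl fun k _ => by ring
    _ ≤ _ := by
        have : β * (b - a) ^ 2 / n ^ 2 * (n * x * (1 - x)) = β * (b - a) ^ 2 / n * (x * (1 - x)) := by
          field_simp
        rw [this]
        have h2 : 0 ≤ β * (b - a) ^ 2 / n := by positivity
        have h3 : x * (1 - x) ≤ 1 := by nlinarith [hx01.1, hx01.2]
        linarith [mul_le_of_le_one_right h2 h3]

end VectorPolynomial

/-! ### Interpolation at the Legendre nodes -/

section Interpolation

open Polynomial

variable {d : ℕ}

theorem injOn_id_nodes (h : ℝ) (N : ℕ) : Set.InjOn (id : ℝ → ℝ) (nodes h N) :=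
  Function.injective_id.injOn

theorem Pplus_mem_vpoly {h : ℝ} (hh : 0 < h) (N : ℕ) (W : nodes h N → E d) :
    Pplus h N W ∈ vpoly d N := by
  refine sum_smul_mem_vpoly _ (fun x _ => ?_) W
  rw [Lagrange.degree_basis (injOn_id_nodes h N) x.2, card_nodes hh]
  norm_cast
  have : 0 < (nodes h N).card := Finset.card_pos.2 ⟨_, x.2⟩
  rw [card_nodes hh] at this
  omega

theorem Pplus_add (h : ℝ) (N : ℕ) (W W' : nodes h N → E d) :
    Pplus h N (W + W') = Pplus h N W + Pplus h N W' := by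
  ext1 t; simp [Pplus, Finset.sum_add_distrib]

theorem Pplus_smul (h : ℝ) (N : ℕ) (c : ℝ) (W : nodes h N → E d) :
    Pplus h N (c • W) = c • Pplus h N W := by
  ext1 t; simp [Pplus, Finset.smul_sum, smul_comm c]

theorem Pplus_sub (h : ℝ) (N : ℕ) (W W' : nodes h N → E d) :
    Pplus h N (W - W') = Pplus h N W - Pplus h N W' := by
  ext1 t; simp [Pplus, Finset.sum_sub_distrib, smul_sub]

theorem Pplus_eval {h : ℝ} (hh : 0 < h) {N : ℕ} {f : ℝ → E d} (hf : f ∈ vpoly d N) :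
    Pplus h N (fun x => f x) = f := by
  induction hf using Submodule.span_induction with
  | mem x hx =>
    obtain ⟨p, v, hp, rfl⟩ := hx
    ext1 t
    have h1 := Lagrange.eq_interpolate (injOn_id_nodes h N) (f := p) (by rwa [card_nodes hh])
    have h2 : p.eval t = ∑ x : nodes h N, (Lagrange.basis (nodes h N) id (x : ℝ)).eval t *
        p.eval (x : ℝ) := by
      conv_lhs => rw [h1]
      rw [Lagrange.interpolate_apply, eval_finsetSum, ← Finset.sum_coe_sort]
      simp [mul_comm]
    simp only [Pplus, smul_smul]
    rw [← Finset.sum_smul, ← h2]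
  | zero => ext1 t; simp [Pplus]
  | add x y _ _ hx hy =>
    conv_rhs => rw [← hx, ← hy]
    exact Pplus_add _ _ _ _
  | smul c x _ hx =>
    conv_rhs => rw [← hx]
    exact Pplus_smul _ _ _ _

/-- The product vanishes at every node and has degree $2N-2$, so Gauss exactness applies. The choice
of Legendre zeros as nodes enters the convergence argument here. -/
theorem integral_basis_mul_basis {h : ℝ} (hh : 0 < h) {N : ℕ} {x y : nodes h N} (hxy : x ≠ y) :
    ∫ t in 0..h, (Lagrange.basis (nodes h N) id (x : ℝ)).eval t *
      (Lagrange.basis (nodes h N) id (y : ℝ)).eval t = 0 := by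
  have hpos : 0 < (nodes h N).card := Finset.card_pos.2 ⟨_, x.2⟩
  simp only [← eval_mul]
  refine integral_mul_eq_zero_of_isRoot hh (N := N) (fun z hz => ?_) ?_
  · rw [IsRoot, eval_mul]
    rcases ne_or_eq (x : ℝ) z with h1 | h1
    · have := Lagrange.eval_basis_of_ne (v := (id : ℝ → ℝ)) h1 hz
      rw [id] at this
      rw [this, zero_mul]
    · have h2 : (y : ℝ) ≠ z := fun h2 => hxy (Subtype.ext (h1.trans h2.symm))
      have := Lagrange.eval_basis_of_ne (v := (id : ℝ → ℝ)) h2 hz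
      rw [id] at this
      rw [this, mul_zero]
  · refine natDegree_mul_le.trans_lt ?_
    rw [Lagrange.natDegree_basis (injOn_id_nodes h N) x.2,
      Lagrange.natDegree_basis (injOn_id_nodes h N) y.2]
    rw [card_nodes hh] at hpos ⊢
    omega

/-- By orthogonality the sum is the integral of $(\sum_x\ell_x)^2=1$. The inequality is strict only
when there are no nodes. -/
theorem sum_integral_basis_sq_le {h : ℝ} (hh : 0 < h) (N : ℕ) :
    ∑ x : nodes h N, ∫ t in 0..h, (Lagrange.basis (nodes h N) id (x : ℝ)).eval t ^ 2 ≤ h := by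
  rcases (nodes h N).eq_empty_or_nonempty with he | hne
  · have : IsEmpty (nodes h N) := by rw [he]; infer_instance
    simpa using hh.le
  · have h1 : ∀ t : ℝ, ∑ x : nodes h N, ∑ y : nodes h N,
        (Lagrange.basis (nodes h N) id (x : ℝ)).eval t *
        (Lagrange.basis (nodes h N) id (y : ℝ)).eval t = 1 := by
      intro t
      have h2 : ∑ x : nodes h N, (Lagrange.basis (nodes h N) id (x : ℝ)).eval t = 1 := by
        have := congrArg (eval t) (Lagrange.sum_basis (injOn_id_nodes h N) hne)
        rw [eval_finsetSum, ← Finset.sum_coe_sort] at this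
        simpa using this
      rw [← Finset.sum_mul_sum, h2, one_mul]
    have h3 : ∫ t in 0..h, ∑ x : nodes h N, ∑ y : nodes h N,
        (Lagrange.basis (nodes h N) id (x : ℝ)).eval t *
        (Lagrange.basis (nodes h N) id (y : ℝ)).eval t = h := by
      simp only [h1]; simp
    have hint : ∀ x y : nodes h N, IntervalIntegrable (fun t : ℝ =>
        (Lagrange.basis (nodes h N) id (x : ℝ)).eval t *
        (Lagrange.basis (nodes h N) id (y : ℝ)).eval t) volume 0 h := fun x y =>
      ((Polynomial.continuous _).mul (Polynomial.continuous _)).intervalIntegrable _ _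
    have hsum : ∀ x : nodes h N, IntervalIntegrable (fun t : ℝ => ∑ y : nodes h N,
        (Lagrange.basis (nodes h N) id (x : ℝ)).eval t *
        (Lagrange.basis (nodes h N) id (y : ℝ)).eval t) volume 0 h := fun x =>
      (continuous_finsetSum _ fun y _ =>
        (Polynomial.continuous _).mul (Polynomial.continuous _)).intervalIntegrable _ _
    rw [intervalIntegral.integral_finsetSum fun x _ => hsum x] at h3
    conv_rhs => rw [← h3]
    refine Finset.sum_le_sum fun x _ => le_of_eq ?_
    rw [intervalIntegral.integral_finsetSum fun y _ => hint x y,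
      Finset.sum_eq_single x (fun y _ hy => integral_basis_mul_basis hh hy.symm) (by simp)]
    simp only [sq]

/-- Orthogonality removes the cross terms, leaving $\sum_x\|\ell_x\|^2|W_x|^2$. The resulting bound
from sup norm to $L^2$ does not grow with `N`, unlike the Lebesgue constants of the sup norm. -/
theorem integral_norm_Pplus_sq_le {h : ℝ} (hh : 0 < h) {N : ℕ} {W : nodes h N → E d} {K : ℝ}
    (hW : ∀ x, ‖W x‖ ≤ K) : ∫ t in Icc 0 h, ‖Pplus h N W t‖ ^ 2 ≤ h * K ^ 2 := by
  rw [integral_Icc_eq_integral_Ioc, ← intervalIntegral.integral_of_le hh.le]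
  have h1 : ∀ t, ‖Pplus h N W t‖ ^ 2 = ∑ x : nodes h N, ∑ y : nodes h N,
      (Lagrange.basis (nodes h N) id (x : ℝ)).eval t *
        (Lagrange.basis (nodes h N) id (y : ℝ)).eval t * inner ℝ (W x) (W y) := by
    intro t
    rw [← real_inner_self_eq_norm_sq, Pplus, sum_inner]
    refine Finset.sum_congr rfl fun x _ => ?_
    rw [inner_sum]
    refine Finset.sum_congr rfl fun y _ => ?_
    rw [real_inner_smul_left, real_inner_smul_right, mul_assoc]
  have hint : ∀ x y : nodes h N, IntervalIntegrable (fun t : ℝ =>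
      (Lagrange.basis (nodes h N) id (x : ℝ)).eval t *
      (Lagrange.basis (nodes h N) id (y : ℝ)).eval t * inner ℝ (W x) (W y)) volume 0 h :=
    fun x y => (((Polynomial.continuous _).mul (Polynomial.continuous _)).mul
      continuous_const).intervalIntegrable _ _
  have hsum : ∀ x : nodes h N, IntervalIntegrable (fun t : ℝ => ∑ y : nodes h N,
      (Lagrange.basis (nodes h N) id (x : ℝ)).eval t *
      (Lagrange.basis (nodes h N) id (y : ℝ)).eval t * inner ℝ (W x) (W y)) volume 0 h := fun x =>
    (continuous_finsetSum _ fun y _ => ((Polynomial.continuous _).mul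
      (Polynomial.continuous _)).mul continuous_const).intervalIntegrable _ _
  simp only [h1]
  rw [intervalIntegral.integral_finsetSum fun x _ => hsum x]
  calc _ = ∑ x : nodes h N, (∫ t in 0..h, (Lagrange.basis (nodes h N) id (x : ℝ)).eval t ^ 2) *
        ‖W x‖ ^ 2 := by
        refine Finset.sum_congr rfl fun x _ => ?_
        rw [intervalIntegral.integral_finsetSum fun y _ => hint x y,
          Finset.sum_eq_single x (fun y _ hy => by
            rw [intervalIntegral.integral_mul_const, integral_basis_mul_basis hh hy.symm,
              zero_mul]) (by simp), intervalIntegral.integral_mul_const, real_inner_self_eq_norm_sq]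
        simp only [sq]
    _ ≤ ∑ x : nodes h N, (∫ t in 0..h, (Lagrange.basis (nodes h N) id (x : ℝ)).eval t ^ 2) *
        K ^ 2 := by
        refine Finset.sum_le_sum fun x _ => mul_le_mul_of_nonneg_left ?_ ?_
        · exact pow_le_pow_left₀ (norm_nonneg _) (hW x) 2
        · exact intervalIntegral.integral_nonneg hh.le fun t _ => sq_nonneg _
    _ ≤ _ := by
        rw [← Finset.sum_mul]
        exact mul_le_mul_of_nonneg_right (sum_integral_basis_sq_le hh N) (sq_nonneg _)

/-- The interpolation error is controlled by the best uniform polynomial approximation. -/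
theorem integral_norm_Pplus_sub_sq_le {h : ℝ} (hh : 0 < h) {N : ℕ} {f p : ℝ → E d} {η : ℝ}
    (hf : ContinuousOn f (Icc 0 h)) (hp : p ∈ vpoly d N)
    (hfp : ∀ t ∈ Icc 0 h, ‖f t - p t‖ ≤ η) :
    ∫ t in Icc 0 h, ‖Pplus h N (fun x => f x) t - f t‖ ^ 2 ≤ 4 * h * η ^ 2 := by
  have hcp := continuous_of_mem_vpoly hp
  have hcP := fun W : nodes h N → E d => continuous_of_mem_vpoly (Pplus_mem_vpoly hh N W)
  have h1 : ∀ t ∈ Icc 0 h, ‖Pplus h N (fun x => f x) t - f t‖ ^ 2 ≤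
      2 * ‖Pplus h N (fun x => f x - p x) t‖ ^ 2 + 2 * η ^ 2 := by
    intro t ht
    -- Interpolation reproduces `p`, so the error is the interpolant of $f-p$ minus $f-p$ itself;
    -- each of the two pieces costs at most $2h\eta^2$.
    have e : Pplus h N (fun x => f x) t - f t =
        Pplus h N (fun x => f x - p x) t - (f t - p t) := by
      have h2 := Pplus_sub h N (fun x => f x) (fun x => p x)
      rw [Pplus_eval hh hp] at h2
      have h3 := congrFun h2 t
      simp only [Pi.sub_apply] at h3
      change Pplus h N (fun x => f x - p x) t = _ at h3
      rw [h3]; abel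
    rw [e]
    have h4 := norm_sub_le (Pplus h N (fun x => f x - p x) t) (f t - p t)
    have h5 := hfp t ht
    have h6 := norm_nonneg (Pplus h N (fun x => f x - p x) t - (f t - p t))
    have h7 := norm_nonneg (f t - p t)
    nlinarith [sq_nonneg (‖Pplus h N (fun x => f x - p x) t‖ - η)]
  have hi1 : IntegrableOn (fun t => ‖Pplus h N (fun x => f x) t - f t‖ ^ 2) (Icc 0 h) :=
    (((hcP _).continuousOn.sub hf).norm.pow 2).integrableOn_Icc
  have hi2 : IntegrableOn (fun t => 2 * ‖Pplus h N (fun x => f x - p x) t‖ ^ 2) (Icc 0 h) :=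
    (((hcP _).norm.pow 2).const_mul 2).continuousOn.integrableOn_Icc
  have hi3 : IntegrableOn (fun _ => 2 * η ^ 2) (Icc 0 h) :=
    continuous_const.continuousOn.integrableOn_Icc
  refine (setIntegral_mono_on hi1 (hi2.add hi3) measurableSet_Icc h1).trans ?_
  change ∫ t in Icc 0 h, (2 * ‖Pplus h N (fun x => f x - p x) t‖ ^ 2 + 2 * η ^ 2) ≤ _
  rw [integral_add hi2 hi3, integral_const_mul, integral_const]
  have h8 := integral_norm_Pplus_sq_le hh (N := N) (W := fun x => f x - p x) (K := η)
    fun x => hfp x (Ioo_subset_Icc_self (nodes_subset hh x.2))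
  simp [hh.le]
  nlinarith

/-- Interpolation at the Legendre nodes converges in `L²`, uniformly on functions with a common
Hölder bound of exponent `1/2`. -/
theorem exists_interpolation_rate (d : ℕ) {h : ℝ} (hh : 0 < h) {ε : ℝ} (hε : 0 < ε) :
    ∃ N₀ : ℕ, ∀ N ≥ N₀, ∀ (f : ℝ → E d) (κ : ℝ), 0 ≤ κ →
      (∀ x ∈ Icc 0 h, ∀ y ∈ Icc 0 h, ‖f x - f y‖ ≤ κ * √|x - y|) →
      ContinuousOn f (Icc 0 h) →
      ∫ t in Icc 0 h, ‖Pplus h N (fun x => f x) t - f t‖ ^ 2 ≤ (ε * κ) ^ 2 := by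
  -- Chosen so that the uniform error $2\kappa\delta$ gives
  -- $4h(2\kappa\delta)^2=(\varepsilon\kappa)^2$ exactly.
  set δ : ℝ := ε / (4 * √h) with hδ
  have hsh : 0 < √h := Real.sqrt_pos.2 hh
  have hδ0 : 0 < δ := by positivity
  obtain ⟨n₀, hn₀⟩ := exists_nat_gt (h ^ 2 / δ ^ 4)
  -- With $N=n+1$, Bernstein polynomials of order $n$ have degree below $N$; the offset 2 makes $n$
  -- positive and at least `n₀`.
  refine ⟨n₀ + 2, fun N hN f κ hκ hf hfc => ?_⟩
  obtain ⟨n, rfl⟩ : ∃ n, N = n + 1 := ⟨N - 1, by omega⟩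
  have hn : 0 < n := by omega
  have hnR : (0 : ℝ) < n := by exact_mod_cast hn
  -- The Hölder bound becomes a quadratic majorant through $s\le\delta+s^4/\delta^3$ with
  -- $s=\sqrt{|x-y|}$, checked separately for $s\le\delta$ and $s\ge\delta$.
  obtain ⟨p, hp, hfp⟩ := exists_vpoly_approx hh hn (f := f) (α := κ * δ) (β := κ / δ ^ 3)
    (by positivity) (fun x hx y hy => by
      refine (hf x hx y hy).trans ?_
      set s := √|x - y| with hs
      have hs0 : 0 ≤ s := Real.sqrt_nonneg _
      have hs4 : (x - y) ^ 2 = s ^ 4 := by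
        have : s ^ 2 = |x - y| := Real.sq_sqrt (abs_nonneg _)
        rw [← sq_abs, ← this]; ring
      rw [hs4, show κ * δ + κ / δ ^ 3 * s ^ 4 = κ * (δ + s ^ 4 / δ ^ 3) by ring]
      refine mul_le_mul_of_nonneg_left ?_ hκ
      rcases le_total s δ with h1 | h1
      · have : 0 ≤ s ^ 4 / δ ^ 3 := by positivity
        linarith
      · have : s ≤ s ^ 4 / δ ^ 3 := by
          rw [le_div_iff₀ (by positivity)]
          have : δ ^ 3 ≤ s ^ 3 := pow_le_pow_left₀ hδ0.le h1 3
          nlinarith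
        linarith)
  have hb : κ * δ + κ / δ ^ 3 * (h - 0) ^ 2 / n ≤ 2 * (κ * δ) := by
    have h2 : h ^ 2 / δ ^ 4 ≤ n := hn₀.le.trans (by exact_mod_cast (by omega : n₀ ≤ n))
    rw [div_le_iff₀ (by positivity)] at h2
    have : κ / δ ^ 3 * (h - 0) ^ 2 / n ≤ κ * δ := by
      rw [sub_zero, div_le_iff₀ hnR, div_mul_eq_mul_div, div_le_iff₀ (by positivity)]
      nlinarith
    linarith
  refine (integral_norm_Pplus_sub_sq_le hh hfc hp fun t ht => (hfp t ht).trans hb).trans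
    (le_of_eq ?_)
  rw [hδ]
  field_simp
  rw [Real.sq_sqrt hh.le]
  ring

end Interpolation


/-! ### Continuous representatives of `H¹` functions -/

section Sobolev

variable {d : ℕ}

/-- Cauchy–Schwarz against the constant 1, read off from $\int(m\|g\|-a)^2\ge0$, where $m$ is the
total mass and $a$ the integral of the norm. -/
theorem sq_integral_norm_le {α G : Type*} [MeasurableSpace α] [NormedAddCommGroup G]
    {μ : Measure α} [IsFiniteMeasure μ] {g : α → G} (hg : MemLp g 2 μ) :
    (∫ t, ‖g t‖ ∂μ) ^ 2 ≤ μ.real univ * ∫ t, ‖g t‖ ^ 2 ∂μ := by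
  have hi1 : Integrable (fun t => ‖g t‖) μ := (hg.integrable one_le_two).norm
  have hi2 : Integrable (fun t => ‖g t‖ ^ 2) μ := hg.integrable_norm_pow (by norm_num)
  set m := μ.real univ
  set a := ∫ t, ‖g t‖ ∂μ
  rcases (measureReal_nonneg : 0 ≤ m).eq_or_lt with hm | hm
  · have : μ = 0 := by
      rw [← Measure.measure_univ_eq_zero]
      exact (measureReal_eq_zero_iff).1 hm.symm
    have ha : a = 0 := by simp [a, this]
    rw [ha, zero_pow two_ne_zero]
    exact mul_nonneg measureReal_nonneg (integral_nonneg fun t => sq_nonneg _)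
  · have h0 : 0 ≤ ∫ t, (m * ‖g t‖ - a) ^ 2 ∂μ := integral_nonneg fun t => sq_nonneg _
    have h1 : ∀ t, (m * ‖g t‖ - a) ^ 2 = (m ^ 2 * ‖g t‖ ^ 2 - (2 * m * a) * ‖g t‖) + a ^ 2 :=
      fun t => by ring
    simp only [h1] at h0
    have e2 : Integrable (fun t => m ^ 2 * ‖g t‖ ^ 2) μ := hi2.const_mul _
    have e1 : Integrable (fun t => 2 * m * a * ‖g t‖) μ := hi1.const_mul _
    have e3 : Integrable (fun t => m ^ 2 * ‖g t‖ ^ 2 - 2 * m * a * ‖g t‖) μ := e2.sub e1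
    rw [integral_add e3 (integrable_const _), integral_sub e2 e1, integral_const_mul, integral_const_mul,
      integral_const, smul_eq_mul] at h0
    change 0 ≤ m ^ 2 * _ - 2 * m * a * a + m * a ^ 2 at h0
    have h2 : 0 ≤ m * (m * (∫ t, ‖g t‖ ^ 2 ∂μ) - a ^ 2) := by linarith
    linarith [nonneg_of_mul_nonneg_right h2 hm]

/-- Cauchy–Schwarz on the interval between the two points: this is where the Hölder exponent $1/2$
comes from. -/
theorem norm_primitive_sub_le {h : ℝ} {g : ℝ → E d}
    (hg : MemLp g 2 (volume.restrict (Icc 0 h))) {x y : ℝ} (hx : x ∈ Icc 0 h) (hy : y ∈ Icc 0 h) :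
    ‖(∫ t in 0..x, g t) - ∫ t in 0..y, g t‖ ≤ √(∫ t in Icc 0 h, ‖g t‖ ^ 2) * √|x - y| := by
  have hgi : IntegrableOn g (Icc 0 h) := hg.integrable one_le_two
  have hint : ∀ z ∈ Icc 0 h, IntervalIntegrable g volume 0 z := fun z hz =>
    (intervalIntegrable_iff_integrableOn_Icc_of_le hz.1).2
      (hgi.mono_set (Icc_subset_Icc_right hz.2))
  rw [intervalIntegral.integral_interval_sub_left (hint x hx) (hint y hy)]
  refine (intervalIntegral.norm_integral_le_integral_norm_uIoc).trans ?_
  have hsub : uIoc y x ⊆ Icc 0 h := uIoc_subset_uIcc.trans (uIcc_subset_Icc hy hx)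
  have : IsFiniteMeasure (volume.restrict (uIoc y x)) := ⟨by simp [Real.volume_uIoc]⟩
  have h1 := sq_integral_norm_le (hg.mono_measure (Measure.restrict_mono hsub le_rfl))
  have h2 : ∫ t in uIoc y x, ‖g t‖ ^ 2 ≤ ∫ t in Icc 0 h, ‖g t‖ ^ 2 :=
    setIntegral_mono_set (hg.integrable_norm_pow (by norm_num))
      (Eventually.of_forall fun t => sq_nonneg _) hsub.eventuallyLE
  rw [← Real.sqrt_mul (integral_nonneg fun t => sq_nonneg _)]
  refine Real.le_sqrt_of_sq_le (h1.trans ?_)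
  have h3 : (volume.restrict (uIoc y x)).real univ = |x - y| := by
    simp [measureReal_def, uIoc_comm, Real.volume_uIoc, abs_sub_comm]
  rw [h3, mul_comm]
  exact mul_le_mul_of_nonneg_right h2 (abs_nonneg _)

/-- Integration by parts against a test function. -/
theorem integral_deriv_smul_primitive {h : ℝ} {g : ℝ → E d}
    (hg : IntegrableOn g (Icc 0 h)) {η : ℝ → ℝ} (hη : ContDiff ℝ 1 η)
    (hsupp : tsupport η ⊆ Ioo 0 h) :
    ∫ t in Icc 0 h, deriv η t • ∫ s in 0..t, g s = - ∫ t in Icc 0 h, η t • g t := by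
  have hd : Continuous (deriv η) := hη.continuous_deriv le_rfl
  set μ := volume.restrict (Icc 0 h) with hμ
  -- Fubini on the triangle $s\le t$: integrating in $s$ first gives the primitive of `g`,
  -- integrating in $t$ first gives $\eta(h)-\eta(s)=-\eta(s)$.
  set k : ℝ → ℝ → E d := fun t s => {p : ℝ × ℝ | p.2 ≤ p.1}.indicator
    (fun p => deriv η p.1 • g p.2) (t, s) with hk
  have hki : Integrable (Function.uncurry k) (μ.prod μ) := by
    have h1 : Integrable (fun p : ℝ × ℝ => deriv η p.1 • g p.2) (μ.prod μ) :=
      Integrable.smul_prod (f := deriv η) hd.continuousOn.integrableOn_Icc hg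
    exact h1.indicator (measurableSet_le measurable_snd measurable_fst)
  have hswap := integral_integral_swap hki
  have h1 : ∀ t ∈ Icc 0 h, ∫ s, k t s ∂μ = deriv η t • ∫ s in 0..t, g s := by
    intro t ht
    have : (fun s => k t s) = (Iic t).indicator (fun s => deriv η t • g s) := by
      ext1 s; simp [hk, indicator]
    rw [this, integral_indicator measurableSet_Iic, hμ, Measure.restrict_restrict measurableSet_Iic,
      integral_smul, intervalIntegral.integral_of_le ht.1, ← integral_Icc_eq_integral_Ioc]
    congr 3
    ext s; simp only [mem_inter_iff, mem_Iic, mem_Icc]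
    exact ⟨fun hs => ⟨hs.2.1, hs.1⟩, fun hs => ⟨hs.2, hs.1, hs.2.trans ht.2⟩⟩
  have hηh : η h = 0 := by
    by_contra hne
    exact (hsupp (subset_tsupport _ hne)).2.false
  have h2 : ∀ s ∈ Icc 0 h, ∫ t, k t s ∂μ = - (η s • g s) := by
    intro s hs
    have : (fun t => k t s) = (Ici s).indicator (fun t => deriv η t • g s) := by
      ext1 t; simp [hk, indicator]
    rw [this, integral_indicator measurableSet_Ici, hμ, Measure.restrict_restrict measurableSet_Ici,
      integral_smul_const]
    have hset : Ici s ∩ Icc 0 h = Icc s h := by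
      ext t; simp only [mem_inter_iff, mem_Ici, mem_Icc]
      exact ⟨fun ht => ⟨ht.1, ht.2.2⟩, fun ht => ⟨ht.1, hs.1.trans ht.1, ht.2⟩⟩
    rw [hset, integral_Icc_eq_integral_Ioc, ← intervalIntegral.integral_of_le hs.2,
      intervalIntegral.integral_deriv_eq_sub
        (fun x _ => (hη.differentiable one_ne_zero).differentiableAt)
        (hd.intervalIntegrable _ _), hηh, zero_sub, neg_smul]
  rw [setIntegral_congr_fun measurableSet_Icc (fun t ht => (h1 t ht).symm), hswap,
    setIntegral_congr_fun measurableSet_Icc h2, integral_neg]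

/-- A function whose weak derivative vanishes is constant. -/
theorem ae_eq_const_of_integral_deriv_smul {h : ℝ} (hh : 0 < h) {u : ℝ → E d}
    (hu : IntegrableOn u (Icc 0 h))
    (hu0 : ∀ η : ℝ → ℝ, ContDiff ℝ 1 η → HasCompactSupport η → tsupport η ⊆ Ioo 0 h →
      ∫ t in Icc 0 h, deriv η t • u t = 0) :
    ∃ c : E d, ∀ᵐ t ∂(volume.restrict (Icc 0 h)), u t = c := by
  -- A bump supported in $[h/4,3h/4]$, normalised to integral one. The constant will be the mean of
  -- `u` weighted by it.
  set b : ContDiffBump (h / 2) := ⟨h / 8, h / 4, by positivity, by linarith⟩ with hb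
  set ρ : ℝ → ℝ := b.normed volume with hρ
  have hρc : Continuous ρ := b.continuous_normed
  have hρs : tsupport ρ ⊆ Ioo 0 h := by
    rw [hρ, b.tsupport_normed_eq, Real.closedBall_eq_Icc]
    refine Icc_subset_Ioo ?_ ?_ <;> simp only [hb] <;> linarith
  have hρ1 : ∫ t in 0..h, ρ t = 1 := by
    rw [← b.integral_normed (μ := volume), intervalIntegral.integral_of_le hh.le]
    refine setIntegral_eq_integral_of_forall_compl_eq_zero fun t ht => ?_
    by_contra hne
    exact ht (Ioo_subset_Ioc_self (hρs (subset_tsupport _ hne)))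
  set c : E d := ∫ t in Icc 0 h, ρ t • u t with hc
  have hci : ∀ {ζ : ℝ → ℝ}, Continuous ζ → IntegrableOn (fun t => ζ t • u t) (Icc 0 h) :=
    fun hζ => hu.continuousOn_smul hζ.continuousOn isCompact_Icc
  refine ⟨c, ?_⟩
  have key := isOpen_Ioo.ae_eq_zero_of_integral_contDiff_smul_eq_zero (U := Ioo 0 h)
    (f := fun t => u t - c) (μ := volume) ?_ ?_
  · rw [← restrict_Ioo_eq_restrict_Icc, ae_restrict_iff' measurableSet_Ioo]
    filter_upwards [key] with t ht hmem using sub_eq_zero.1 (ht hmem)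
  · exact ((hu.sub (continuous_const.continuousOn.integrableOn_Icc)).mono_set
      Ioo_subset_Icc_self).locallyIntegrableOn
  · intro ζ hζ hζc hζs
    have hζcont : Continuous ζ := hζ.continuous
    set Z := ∫ t in 0..h, ζ t with hZ
    -- The du Bois-Reymond device: subtracting $Z\rho$ makes the integral zero, so the primitive
    -- vanishes near both ends and is an admissible test function.
    set w : ℝ → ℝ := fun t => ζ t - Z * ρ t with hw
    have hwc : Continuous w := hζcont.sub (hρc.const_mul _)
    have hws : ∀ t, t ∉ tsupport ζ ∪ tsupport ρ → w t = 0 := by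
      intro t ht
      rw [mem_union, not_or] at ht
      simp [hw, image_eq_zero_of_notMem_tsupport ht.1, image_eq_zero_of_notMem_tsupport ht.2]
    have hK : IsCompact (tsupport ζ ∪ tsupport ρ) :=
      hζc.isCompact.union b.hasCompactSupport_normed.isCompact
    have hKs : tsupport ζ ∪ tsupport ρ ⊆ Ioo 0 h := union_subset hζs hρs
    have hKne : (tsupport ζ ∪ tsupport ρ).Nonempty := by
      refine ⟨h / 2, Or.inr ?_⟩
      rw [hρ, b.tsupport_normed_eq]
      exact Metric.mem_closedBall_self b.rOut_pos.le
    obtain ⟨p, hp, hpmin⟩ := hK.exists_isLeast hKne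
    obtain ⟨q, hq, hqmax⟩ := hK.exists_isGreatest hKne
    set η : ℝ → ℝ := fun t => ∫ s in 0..t, w s with hη
    have hderiv : ∀ t, HasDerivAt η (w t) t := fun t => hwc.integral_hasStrictDerivAt 0 t |>.hasDerivAt
    have hderiv' : deriv η = w := funext fun t => (hderiv t).deriv
    have hη1 : ContDiff ℝ 1 η := by
      rw [contDiff_one_iff_deriv, hderiv']
      exact ⟨fun t => (hderiv t).differentiableAt, hwc⟩
    have hw0 : ∫ s in 0..h, w s = 0 := by
      simp only [hw]
      rw [intervalIntegral.integral_sub (hζcont.intervalIntegrable _ _)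
        ((hρc.const_mul _).intervalIntegrable _ _), intervalIntegral.integral_const_mul, hρ1]
      simp [hZ]
    have hout : ∀ t, t ∉ Icc p q → η t = 0 := by
      intro t ht
      rw [mem_Icc, not_and_or, not_le, not_le] at ht
      rcases ht with ht | ht
      · rw [hη]
        have : EqOn w 0 (uIcc 0 t) := fun s hs => hws s fun hs' => by
          have h1 := hpmin hs'
          have h2 : s ≤ max 0 t := hs.2
          have h3 := (hKs hp).1
          rcases le_max_iff.1 h2 with h4 | h4 <;> linarith
        simp [intervalIntegral.integral_congr this]
      · have : EqOn w 0 (uIcc h t) := fun s hs => hws s fun hs' => by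
          have h1 := hqmax hs'
          have h2 : min h t ≤ s := hs.1
          have h3 := (hKs hq).2
          rcases min_le_iff.1 h2 with h4 | h4 <;> linarith
        have h5 := intervalIntegral.integral_add_adjacent_intervals (hwc.intervalIntegrable 0 h)
          (hwc.intervalIntegrable (μ := volume) h t)
        rw [hw0, intervalIntegral.integral_congr this] at h5
        simpa using h5.symm
    have hηsupp : tsupport η ⊆ Icc p q := closure_minimal
      (fun t ht => by by_contra hn; exact ht (hout t hn)) isClosed_Icc
    have h0 := hu0 η hη1 (HasCompactSupport.intro isCompact_Icc hout)
      (hηsupp.trans (Icc_subset_Ioo (hKs hp).1 (hKs hq).2))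
    rw [hderiv'] at h0
    simp only [hw, sub_smul, mul_smul] at h0
    have e : IntegrableOn (fun t => Z • ρ t • u t) (Icc 0 h) := (hci hρc).smul Z
    rw [integral_sub (hci hζcont) e, integral_smul] at h0
    have h1 : ∫ t, ζ t • (u t - c) = ∫ t in Icc 0 h, ζ t • (u t - c) := by
      symm
      refine setIntegral_eq_integral_of_forall_compl_eq_zero fun t ht => ?_
      rw [image_eq_zero_of_notMem_tsupport fun hm => ht (Ioo_subset_Icc_self (hζs hm)), zero_smul]
    have h2 : ∫ t in Icc 0 h, ζ t • c = Z • c := by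
      rw [integral_smul_const, integral_Icc_eq_integral_Ioc, ← intervalIntegral.integral_of_le hh.le]
    rw [h1]
    simp only [smul_sub]
    rw [integral_sub (hci hζcont) (hζcont.continuousOn.integrableOn_Icc.smul_const c), h2, ← h0]

/-- The difference between `f` and the primitive of `g` has zero weak derivative, hence is a
constant; the primitive plus that constant is the representative. -/
theorem HasWeakDeriv.exists_continuousOn {h : ℝ} (hh : 0 < h) {f g : ℝ → E d}
    (hf : MemLp f 2 (volume.restrict (Icc 0 h))) (hg : HasWeakDeriv h f g) :
    ∃ f' : ℝ → E d, ContinuousOn f' (Icc 0 h) ∧ f' =ᵐ[volume.restrict (Icc 0 h)] f ∧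
      ∀ x ∈ Icc 0 h, ∀ y ∈ Icc 0 h,
        ‖f' x - f' y‖ ≤ √(∫ t in Icc 0 h, ‖g t‖ ^ 2) * √|x - y| := by
  have hgi : IntegrableOn g (Icc 0 h) := hg.1.integrable one_le_two
  have hfi : IntegrableOn f (Icc 0 h) := hf.integrable one_le_two
  have hGc : ContinuousOn (fun t => ∫ s in 0..t, g s) (Icc 0 h) := by
    have := intervalIntegral.continuousOn_primitive_interval (a := 0) (b := h) (μ := volume) (f := g)
      (by rwa [uIcc_of_le hh.le])
    rwa [uIcc_of_le hh.le] at this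
  obtain ⟨c, hc⟩ := ae_eq_const_of_integral_deriv_smul hh
    (u := fun t => f t - ∫ s in 0..t, g s) (hfi.sub hGc.integrableOn_Icc) (by
      intro η hη hηc hηs
      have hd : Continuous (deriv η) := hη.continuous_deriv le_rfl
      simp only [smul_sub]
      rw [integral_sub (hfi.continuousOn_smul hd.continuousOn isCompact_Icc)
        ((hGc.integrableOn_Icc).continuousOn_smul hd.continuousOn isCompact_Icc),
        integral_deriv_smul_primitive hgi hη hηs, hg.2 η hη hηc hηs, sub_self])
  refine ⟨fun t => (∫ s in 0..t, g s) + c, hGc.add continuousOn_const, ?_, fun x hx y hy => ?_⟩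
  · filter_upwards [hc] with t ht
    rw [← ht]; abel
  · rw [add_sub_add_right_eq_sub]
    exact norm_primitive_sub_le hg.1 hx hy

/-- Functions continuous on a nondegenerate interval that agree almost everywhere agree at every
point, so the arbitrary choice in `contRep` is harmless on $[0,h]$. -/
theorem contRep_eq {h : ℝ} (hh : 0 < h) {f g : ℝ → E d} (hg : ContinuousOn g (Icc 0 h))
    (hgf : g =ᵐ[volume.restrict (Icc 0 h)] f) : EqOn (contRep h f) g (Icc 0 h) := by
  have h1 := Classical.epsilon_spec (p := fun g => ContinuousOn g (Icc 0 h) ∧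
    g =ᵐ[volume.restrict (Icc 0 h)] f) ⟨g, hg, hgf⟩
  exact Measure.eqOn_Icc_of_ae_eq (μ := volume) hh.ne (h1.2.trans hgf.symm) h1.1 hg

theorem MemH1.hasWeakDeriv {h : ℝ} {f : ℝ → E d} (hf : MemH1 h f) :
    HasWeakDeriv h f (weakDeriv h f) := Classical.epsilon_spec hf.2

theorem MemH1.contRep_spec {h : ℝ} (hh : 0 < h) {f : ℝ → E d} (hf : MemH1 h f) :
    ContinuousOn (contRep h f) (Icc 0 h) ∧ contRep h f =ᵐ[volume.restrict (Icc 0 h)] f := by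
  obtain ⟨g, hg, hgf, -⟩ := hf.hasWeakDeriv.exists_continuousOn hh hf.1
  exact Classical.epsilon_spec (p := fun g => ContinuousOn g (Icc 0 h) ∧
    g =ᵐ[volume.restrict (Icc 0 h)] f) ⟨g, hg, hgf⟩

theorem MemH1.norm_contRep_sub_le {h : ℝ} (hh : 0 < h) {f : ℝ → E d} (hf : MemH1 h f) {x y : ℝ}
    (hx : x ∈ Icc 0 h) (hy : y ∈ Icc 0 h) :
    ‖contRep h f x - contRep h f y‖ ≤ h1Norm h f * √|x - y| := by
  obtain ⟨g, hg, hgf, hgh⟩ := hf.hasWeakDeriv.exists_continuousOn hh hf.1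
  rw [contRep_eq hh hg hgf hx, contRep_eq hh hg hgf hy]
  refine (hgh x hx y hy).trans (mul_le_mul_of_nonneg_right (Real.sqrt_le_sqrt ?_)
    (Real.sqrt_nonneg _))
  exact le_add_of_nonneg_left (integral_nonneg fun t => sq_nonneg _)

theorem MemH1.sqrt_integral_le {h : ℝ} {f : ℝ → E d} :
    √(∫ t in Icc 0 h, ‖f t‖ ^ 2) ≤ h1Norm h f :=
  Real.sqrt_le_sqrt (le_add_of_nonneg_right (integral_nonneg fun _ => sq_nonneg _))

/-- The Sobolev embedding `H¹([0,h]) ⊂ C([0,h])`. -/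
theorem MemH1.norm_contRep_le {h : ℝ} (hh : 0 < h) {f : ℝ → E d} (hf : MemH1 h f) {x : ℝ}
    (hx : x ∈ Icc 0 h) : ‖contRep h f x‖ ≤ (√h / h + √h) * h1Norm h f := by
  have hs := hf.contRep_spec hh
  have hn : 0 ≤ h1Norm h f := Real.sqrt_nonneg _
  have hvol : (volume.restrict (Icc 0 h)).real univ = h := by simp [measureReal_def, hh.le]
  have h1 : ∫ y in Icc 0 h, ‖f y‖ ≤ √h * h1Norm h f := by
    have h2 := sq_integral_norm_le hf.1
    rw [hvol] at h2
    refine (Real.le_sqrt_of_sq_le h2).trans ?_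
    rw [Real.sqrt_mul hh.le]
    exact mul_le_mul_of_nonneg_left sqrt_integral_le (Real.sqrt_nonneg _)
  -- The Hölder estimate bounds the value at $x$ by the value at $y$ plus $\sqrt h$ times the $H^1$
  -- norm; averaging over $y$ leaves an $L^1$ norm.
  have h3 : ∫ _ in Icc 0 h, ‖contRep h f x‖ ≤
      ∫ y in Icc 0 h, (‖f y‖ + h1Norm h f * √h) := by
    refine integral_mono_ae (integrable_const _)
      ((hf.1.integrable one_le_two).norm.add (integrable_const _)) ?_
    filter_upwards [hs.2, ae_restrict_mem measurableSet_Icc] with y hy hmem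
    rw [← hy]
    have h4 := hf.norm_contRep_sub_le hh hx hmem
    have h5 : |x - y| ≤ h := abs_sub_le_iff.2 ⟨by linarith [hx.2, hmem.1], by linarith [hx.1, hmem.2]⟩
    have h6 := mul_le_mul_of_nonneg_left (Real.sqrt_le_sqrt h5) hn
    have h7 := norm_le_norm_add_norm_sub' (contRep h f x) (contRep h f y)
    linarith
  rw [integral_add (hf.1.integrable one_le_two).norm (integrable_const _), integral_const,
    integral_const, hvol, smul_eq_mul, smul_eq_mul] at h3
  have h8 : h * ‖contRep h f x‖ ≤ h * ((√h / h + √h) * h1Norm h f) := by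
    have : h * ((√h / h + √h) * h1Norm h f) = √h * h1Norm h f + h * (h1Norm h f * √h) := by
      field_simp
    linarith
  exact le_of_mul_le_mul_left h8 hh

/-- The two defining predicates coincide, so `Classical.epsilon` returns the same function even if
no continuous representative exists. -/
theorem contRep_congr {h : ℝ} {f g : ℝ → E d} (hfg : f =ᵐ[volume.restrict (Icc 0 h)] g) :
    contRep h f = contRep h g := by
  have : (fun u : ℝ → E d => ContinuousOn u (Icc 0 h) ∧ u =ᵐ[volume.restrict (Icc 0 h)] f) =
      fun u => ContinuousOn u (Icc 0 h) ∧ u =ᵐ[volume.restrict (Icc 0 h)] g := by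
    ext1 u
    exact propext (and_congr_right fun _ => ⟨fun h => h.trans hfg, fun h => h.trans hfg.symm⟩)
  simp only [contRep, this]

end Sobolev


/-! ### Interpolation of operators into `H¹` -/

section Operators

open Polynomial

variable {d : ℕ}

theorem L2_norm_sq {α : Type*} [MeasurableSpace α] {μ : Measure α} (u : Lp (E d) 2 μ) :
    ‖u‖ ^ 2 = ∫ t, ‖u t‖ ^ 2 ∂μ := by
  rw [← real_inner_self_eq_norm_sq, L2.inner_def]
  simp only [real_inner_self_eq_norm_sq]

theorem L2_norm_eq_sqrt {α : Type*} [MeasurableSpace α] {μ : Measure α} {u : Lp (E d) 2 μ}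
    {f : α → E d} (h : u =ᵐ[μ] f) : ‖u‖ = √(∫ t, ‖f t‖ ^ 2 ∂μ) := by
  rw [← Real.sqrt_sq (norm_nonneg u), L2_norm_sq]
  congr 1
  exact integral_congr_ae (h.mono fun t ht => by simp only [ht])

theorem memLp_of_continuous {f : ℝ → E d} (hf : Continuous f) (a b : ℝ) :
    MemLp f 2 (volume.restrict (Icc a b)) := by
  obtain ⟨K, hK⟩ := (isCompact_Icc (a := a) (b := b)).exists_bound_of_continuousOn hf.continuousOn
  refine MemLp.of_bound hf.aestronglyMeasurable K ?_
  filter_upwards [ae_restrict_mem measurableSet_Icc] with t ht using hK t ht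

theorem continuous_eval_smul (p : ℝ[X]) (v : E d) : Continuous fun t => p.eval t • v :=
  p.continuous.smul continuous_const

/-- Multiplication of a scalar polynomial with a vector, as an operator into `L²([a,b])`. -/
def polyOp (d : ℕ) (a b : ℝ) (p : ℝ[X]) : E d →L[ℝ] L2 d a b :=
  LinearMap.toContinuousLinearMap
    { toFun := fun v => (memLp_of_continuous (continuous_eval_smul p v) a b).toLp _
      map_add' := fun v w => by
        rw [← MemLp.toLp_add]
        exact MemLp.toLp_congr _ _ (Eventually.of_forall fun t => smul_add _ _ _)
      map_smul' := fun c v => by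
        rw [RingHom.id_apply, ← MemLp.toLp_const_smul]
        exact MemLp.toLp_congr _ _ (Eventually.of_forall fun t => smul_comm _ _ _) }

theorem coeFn_polyOp (a b : ℝ) (p : ℝ[X]) (v : E d) :
    polyOp d a b p v =ᵐ[volume.restrict (Icc a b)] fun t => p.eval t • v :=
  (memLp_of_continuous (continuous_eval_smul p v) a b).coeFn_toLp

/-- Lagrange interpolation, as an operator into `L²([0,h])`. -/
def pplusOp (d : ℕ) (h : ℝ) (N : ℕ) : (nodes h N → E d) →L[ℝ] L2 d 0 h :=
  ∑ x : nodes h N, polyOp d 0 h (Lagrange.basis (nodes h N) id (x : ℝ)) ∘L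
    ContinuousLinearMap.proj x

theorem coeFn_sum {α ι : Type*} [MeasurableSpace α] {μ : Measure α} (s : Finset ι)
    (u : ι → Lp (E d) 2 μ) : ((∑ i ∈ s, u i : Lp (E d) 2 μ) : α → E d) =ᵐ[μ]
      fun t => ∑ i ∈ s, u i t := by
  classical
  induction s using Finset.induction_on with
  | empty =>
    simp only [Finset.sum_empty]
    exact Lp.coeFn_zero _ _ _
  | insert i s hi ih =>
    simp only [Finset.sum_insert hi]
    filter_upwards [Lp.coeFn_add (u i) (∑ i ∈ s, u i), ih] with t h1 h2
    rw [h1, Pi.add_apply, h2]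

theorem coeFn_pplusOp (h : ℝ) (N : ℕ) (W : nodes h N → E d) :
    pplusOp d h N W =ᵐ[volume.restrict (Icc 0 h)] Pplus h N W := by
  simp only [pplusOp, sum_apply]
  refine (coeFn_sum _ _).trans ?_
  have : ∀ᵐ t ∂(volume.restrict (Icc 0 h)), ∀ x : nodes h N,
      polyOp d 0 h (Lagrange.basis (nodes h N) id (x : ℝ)) (W x) t =
        (Lagrange.basis (nodes h N) id (x : ℝ)).eval t • W x :=
    ae_all_iff.2 fun x => coeFn_polyOp _ _ _ _
  filter_upwards [this] with t ht
  exact Finset.sum_congr rfl fun x _ => ht x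

theorem BoundedIntoH1.exists_bound {Z : Type*} [NormedAddCommGroup Z] {h : ℝ} {G : Z → ℝ → E d}
    (hb : BoundedIntoH1 h G) : ∃ c : ℝ, 0 ≤ c ∧ ∀ a, h1Norm h (G a) ≤ c * ‖a‖ := by
  obtain ⟨c, hc⟩ := hb.2
  exact ⟨max c 0, le_max_right _ _, fun a =>
    (hc a).trans (mul_le_mul_of_nonneg_right (le_max_left _ _) (norm_nonneg a))⟩

variable {Z : Type*} [NormedAddCommGroup Z] [NormedSpace ℝ Z] {h : ℝ} {G : Z → ℝ → E d}

/-- Linearity of a map into functions on `[0,h]`, up to null sets. -/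
structure AELinear (h : ℝ) (G : Z → ℝ → E d) : Prop where
  map_add : ∀ a b, G (a + b) =ᵐ[volume.restrict (Icc 0 h)] G a + G b
  map_smul : ∀ (c : ℝ) a, G (c • a) =ᵐ[volume.restrict (Icc 0 h)] c • G a

/-- An operator bounded into `H¹`, as an operator into `L²`. -/
def h1Op (hb : BoundedIntoH1 h G) (hl : AELinear h G) : Z →L[ℝ] L2 d 0 h :=
  LinearMap.mkContinuousOfExistsBound
    { toFun := fun a => (hb.1 a).1.toLp (G a)
      map_add' := fun a b => by
        rw [← MemLp.toLp_add]
        exact MemLp.toLp_congr _ _ (hl.map_add a b)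
      map_smul' := fun c a => by
        rw [RingHom.id_apply, ← MemLp.toLp_const_smul]
        exact MemLp.toLp_congr _ _ (hl.map_smul c a) }
    (by
      obtain ⟨c, -, hc⟩ := hb.exists_bound
      refine ⟨c, fun a => ?_⟩
      change ‖(hb.1 a).1.toLp (G a)‖ ≤ _
      rw [L2_norm_eq_sqrt (MemLp.coeFn_toLp (hb.1 a).1)]
      exact MemH1.sqrt_integral_le.trans (hc a))

theorem coeFn_h1Op (hb : BoundedIntoH1 h G) (hl : AELinear h G) (a : Z) :
    h1Op hb hl a =ᵐ[volume.restrict (Icc 0 h)] G a :=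
  MemLp.coeFn_toLp (hb.1 a).1

theorem contRep_add (hh : 0 < h) {f g : ℝ → E d} (hf : MemH1 h f) (hg : MemH1 h g) {x : ℝ}
    (hx : x ∈ Icc 0 h) : contRep h (f + g) x = contRep h f x + contRep h g x :=
  contRep_eq hh ((hf.contRep_spec hh).1.add (hg.contRep_spec hh).1)
    ((hf.contRep_spec hh).2.add (hg.contRep_spec hh).2) hx

/-- Evaluation of the continuous representative at a point. -/
def evalOp (hh : 0 < h) (hb : BoundedIntoH1 h G) (hl : AELinear h G) (x : Icc 0 h) : Z →L[ℝ] E d :=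
  LinearMap.mkContinuousOfExistsBound
    { toFun := fun a => contRep h (G a) x
      map_add' := fun a b => by
        rw [contRep_congr (hl.map_add a b), contRep_add hh (hb.1 a) (hb.1 b) x.2]
      map_smul' := fun c a => by
        rw [contRep_congr (hl.map_smul c a)]
        exact contRep_eq hh (((hb.1 a).contRep_spec hh).1.const_smul c)
          (((hb.1 a).contRep_spec hh).2.const_smul c) x.2 }
    (by
      obtain ⟨c, -, hc⟩ := hb.exists_bound
      refine ⟨(√h / h + √h) * c, fun a => ((hb.1 a).norm_contRep_le hh x.2).trans ?_⟩
      rw [mul_assoc]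
      exact mul_le_mul_of_nonneg_left (hc a) (by positivity))

/-- The values at the nodes of the continuous representative. -/
def rplusOp (hh : 0 < h) (hb : BoundedIntoH1 h G) (hl : AELinear h G) (N : ℕ) :
    Z →L[ℝ] (nodes h N → E d) :=
  ContinuousLinearMap.pi fun x => evalOp hh hb hl ⟨x, Ioo_subset_Icc_self (nodes_subset hh x.2)⟩

/-- The composition of an operator into `H¹` with interpolation at the nodes. -/
def interpOp (hh : 0 < h) (hb : BoundedIntoH1 h G) (hl : AELinear h G) (N : ℕ) :
    Z →L[ℝ] L2 d 0 h := pplusOp d h N ∘L rplusOp hh hb hl N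

theorem interpOp_eq_sum (hh : 0 < h) (hb : BoundedIntoH1 h G) (hl : AELinear h G) (N : ℕ) :
    interpOp hh hb hl N = ∑ x : nodes h N,
      polyOp d 0 h (Lagrange.basis (nodes h N) id (x : ℝ)) ∘L
        evalOp hh hb hl ⟨x, Ioo_subset_Icc_self (nodes_subset hh x.2)⟩ := by
  ext1 a
  simp only [interpOp, pplusOp, ContinuousLinearMap.comp_apply, sum_apply]
  rfl

/-- The image of the unit ball has a common $H^1$ bound, hence a common Hölder constant, so the
interpolation error is uniform on it. This is why convergence holds in norm and not only pointwise.
-/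
theorem tendsto_interpOp (hh : 0 < h) (hb : BoundedIntoH1 h G) (hl : AELinear h G) :
    Tendsto (fun N => interpOp hh hb hl N) atTop (𝓝 (h1Op hb hl)) := by
  obtain ⟨c, hc0, hc⟩ := hb.exists_bound
  rw [Metric.tendsto_atTop]
  intro ε hε
  -- Adding 1 to `c` keeps the denominator positive when $c=0$ and still yields $\delta
  -- c<\varepsilon$.
  set δ := ε / (2 * (c + 1)) with hδ
  have hδ0 : 0 < δ := by positivity
  obtain ⟨N₀, hN₀⟩ := exists_interpolation_rate d hh hδ0
  refine ⟨N₀, fun N hN => ?_⟩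
  rw [dist_eq_norm]
  refine lt_of_le_of_lt (ContinuousLinearMap.opNorm_le_bound _ (M := δ * c) (by positivity)
    fun a => ?_) ?_
  · have hs := (hb.1 a).contRep_spec hh
    have hn : 0 ≤ h1Norm h (G a) := Real.sqrt_nonneg _
    have h1 := hN₀ N hN (contRep h (G a)) (h1Norm h (G a)) hn
      (fun x hx y hy => (hb.1 a).norm_contRep_sub_le hh hx hy) hs.1
    have h2 : (interpOp hh hb hl N - h1Op hb hl) a =ᵐ[volume.restrict (Icc 0 h)]
        fun t => Pplus h N (fun x => contRep h (G a) x) t - contRep h (G a) t := by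
      rw [sub_apply]
      filter_upwards [Lp.coeFn_sub (interpOp hh hb hl N a) (h1Op hb hl a), hs.2,
        coeFn_h1Op hb hl a, coeFn_pplusOp h N (rplusOp hh hb hl N a)] with t e1 e2 e3 e4
      rw [e1, Pi.sub_apply, e2, e3]
      congr 1
    rw [L2_norm_eq_sqrt h2]
    refine (Real.sqrt_le_sqrt h1).trans ?_
    rw [Real.sqrt_sq (by positivity), mul_assoc]
    exact mul_le_mul_of_nonneg_left (hc a) hδ0.le
  · rw [hδ, div_mul_eq_mul_div, div_lt_iff₀ (by positivity)]
    nlinarith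

end Operators


/-! ### The Legendre projections -/

section Projection

open Polynomial ContinuousLinearMap

variable {d : ℕ} {τ : ℝ}

theorem integral_Icc_legendre_mul {a b : ℝ} (hab : a < b) {i j : ℕ} (hij : i ≠ j) :
    ∫ t in Icc a b, (legendre a b i).eval t * (legendre a b j).eval t = 0 := by
  rw [integral_Icc_eq_integral_Ioc, ← intervalIntegral.integral_of_le hab.le]
  rcases lt_or_gt_of_ne hij with h | h
  · refine (intervalIntegral.integral_congr fun t _ => mul_comm _ _).trans
      (integral_legendre_mul hab ?_)
    rw [degree_legendre hab]
    exact_mod_cast h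
  · refine integral_legendre_mul hab ?_
    rw [degree_legendre hab]
    exact_mod_cast h

theorem integral_Icc_legendre_sq_pos {a b : ℝ} (hab : a < b) (i : ℕ) :
    0 < ∫ t in Icc a b, (legendre a b i).eval t ^ 2 := by
  rw [integral_Icc_eq_integral_Ioc, ← intervalIntegral.integral_of_le hab.le]
  simp only [← eval_pow]
  refine integral_eval_pos hab (pow_ne_zero _ (legendre_ne_zero hab i)) fun t _ => ?_
  rw [eval_pow]
  exact sq_nonneg _

/-- Legendre coefficients are thereby adjoints of the prolongation terms, up to normalisation, which
makes the projection visibly self-adjoint. -/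
theorem adjoint_polyOp_apply (a b : ℝ) (p : ℝ[X]) (φ : L2 d a b) :
    adjoint (polyOp d a b p) φ = ∫ t in Icc a b, p.eval t • φ t := by
  have hφ : Integrable (fun t => p.eval t • φ t) (volume.restrict (Icc a b)) :=
    IntegrableOn.continuousOn_smul ((Lp.memLp φ).integrable one_le_two)
      p.continuous.continuousOn isCompact_Icc
  refine ext_inner_left ℝ fun v => ?_
  rw [adjoint_inner_right, L2.inner_def, ← integral_inner hφ]
  refine integral_congr_ae ?_
  filter_upwards [coeFn_polyOp a b p v] with t ht
  rw [ht, real_inner_smul_left, real_inner_smul_right]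

theorem adjoint_polyOp_polyOp (a b : ℝ) (p q : ℝ[X]) (v : E d) :
    adjoint (polyOp d a b p) (polyOp d a b q v) =
      (∫ t in Icc a b, p.eval t * q.eval t) • v := by
  rw [adjoint_polyOp_apply, ← integral_smul_const]
  refine integral_congr_ae ?_
  filter_upwards [coeFn_polyOp a b q v] with t ht
  rw [ht, smul_smul]

/-- The orthogonal projection `P_M R_M` of `L²([-τ,0])` onto polynomials of degree at most `M`. -/
def projOp (d : ℕ) (τ : ℝ) (M : ℕ) : L2 d (-τ) 0 →L[ℝ] L2 d (-τ) 0 :=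
  ∑ i : Fin (M + 1), (∫ t in Icc (-τ) 0, (legendre (-τ) 0 i).eval t ^ 2)⁻¹ •
    (polyOp d (-τ) 0 (legendre (-τ) 0 i) ∘L adjoint (polyOp d (-τ) 0 (legendre (-τ) 0 i)))

theorem coeFn_projOp (M : ℕ) (φ : L2 d (-τ) 0) :
    projOp d τ M φ =ᵐ[volume.restrict (Icc (-τ) 0)] P τ M (R τ M φ) := by
  have h0 : projOp d τ M φ = ∑ i : Fin (M + 1),
      polyOp d (-τ) 0 (legendre (-τ) 0 i) (R τ M φ i) := by
    simp only [projOp, sum_apply, smul_apply, comp_apply, adjoint_polyOp_apply, R, legendreCoeff,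
      map_smul]
  rw [h0]
  refine (coeFn_sum _ _).trans ?_
  have : ∀ᵐ t ∂(volume.restrict (Icc (-τ) 0)), ∀ i : Fin (M + 1),
      polyOp d (-τ) 0 (legendre (-τ) 0 i) (R τ M φ i) t =
        (legendre (-τ) 0 i).eval t • R τ M φ i :=
    ae_all_iff.2 fun x => coeFn_polyOp _ _ _ _
  filter_upwards [this] with t ht
  exact Finset.sum_congr rfl fun x _ => ht x

theorem adjoint_projOp (M : ℕ) : adjoint (projOp d τ M) = projOp d τ M := by
  simp only [projOp, map_sum, map_smulₛₗ, adjoint_comp, adjoint_adjoint]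
  rfl

theorem projOp_polyOp_legendre (hτ : 0 < τ) {M i : ℕ} (hi : i < M + 1) (v : E d) :
    projOp d τ M (polyOp d (-τ) 0 (legendre (-τ) 0 i) v) =
      polyOp d (-τ) 0 (legendre (-τ) 0 i) v := by
  have hab : -τ < 0 := by linarith
  simp only [projOp, sum_apply, smul_apply, comp_apply, adjoint_polyOp_polyOp, map_smul, smul_smul]
  rw [Finset.sum_eq_single ⟨i, hi⟩]
  · simp only [← sq]
    rw [inv_mul_cancel₀ (integral_Icc_legendre_sq_pos hab i).ne', one_smul]
  · intro j _ hj
    rw [integral_Icc_legendre_mul hab fun h => hj (Fin.ext h), mul_zero, zero_smul]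
  · simp

theorem polyOp_add (a b : ℝ) (p q : ℝ[X]) (v : E d) :
    polyOp d a b (p + q) v = polyOp d a b p v + polyOp d a b q v := by
  apply Lp.ext
  filter_upwards [coeFn_polyOp a b (p + q) v, coeFn_polyOp a b p v, coeFn_polyOp a b q v,
    Lp.coeFn_add (polyOp d a b p v) (polyOp d a b q v)] with t h1 h2 h3 h4
  rw [h1, h4, Pi.add_apply, h2, h3, eval_add, add_smul]

theorem polyOp_smul (a b : ℝ) (c : ℝ) (p : ℝ[X]) (v : E d) :
    polyOp d a b (c • p) v = c • polyOp d a b p v := by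
  apply Lp.ext
  filter_upwards [coeFn_polyOp a b (c • p) v, coeFn_polyOp a b p v,
    Lp.coeFn_smul c (polyOp d a b p v)] with t h1 h2 h3
  rw [h1, h3, Pi.smul_apply, h2, eval_smul, smul_eq_mul, mul_smul]

/-- The Legendre polynomials have exact degrees $0,1,2,\dots$, so the first $M+1$ of them span all
polynomials of degree at most $M$, and each is fixed. -/
theorem projOp_polyOp (hτ : 0 < τ) {M : ℕ} {p : ℝ[X]} (hp : p.degree < ((M + 1 : ℕ) : WithBot ℕ))
    (v : E d) : projOp d τ M (polyOp d (-τ) 0 p v) = polyOp d (-τ) 0 p v := by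
  have hab : -τ < 0 := by linarith
  set S : Polynomial.Sequence ℝ := ⟨legendre (-τ) 0, degree_legendre hab⟩ with hS
  have hspan := S.span_degreeLT (m := M + 1) fun i _ =>
    (leadingCoeff_ne_zero.2 (S.ne_zero i)).isUnit
  have hp' : p ∈ Submodule.span ℝ (S '' Set.Iio (M + 1)) := by
    rw [hspan]; exact mem_degreeLT.2 hp
  clear hp
  induction hp' using Submodule.span_induction with
  | mem x hx =>
    obtain ⟨i, hi, rfl⟩ := hx
    exact projOp_polyOp_legendre hτ hi v
  | zero =>
    have h0 : polyOp d (-τ) 0 (0 : ℝ[X]) v = 0 := by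
      simpa using polyOp_smul (-τ) 0 0 (0 : ℝ[X]) v
    rw [h0, map_zero]
  | add x y _ _ hx hy => rw [polyOp_add, map_add, hx, hy]
  | smul c x _ hx => rw [polyOp_smul, map_smul, hx]

/-- The projections fix polynomials of sufficiently low degree. -/
theorem projOp_of_mem_vpoly (hτ : 0 < τ) {M : ℕ} {f : ℝ → E d} (hf : f ∈ vpoly d (M + 1))
    {u : L2 d (-τ) 0} (hu : u =ᵐ[volume.restrict (Icc (-τ) 0)] f) : projOp d τ M u = u := by
  induction hf using Submodule.span_induction generalizing u with
  | mem x hx =>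
    obtain ⟨p, v, hp, rfl⟩ := hx
    have : u = polyOp d (-τ) 0 p v := Lp.ext (hu.trans (coeFn_polyOp _ _ _ _).symm)
    rw [this, projOp_polyOp hτ hp]
  | zero =>
    have : u = 0 := Lp.ext (hu.trans (Lp.coeFn_zero _ _ _).symm)
    rw [this, map_zero]
  | add x y hx hy ihx ihy =>
    have h1 := memLp_of_continuous (continuous_of_mem_vpoly (n := M + 1) hx) (-τ) 0
    have h2 := memLp_of_continuous (continuous_of_mem_vpoly (n := M + 1) hy) (-τ) 0
    have : u = h1.toLp x + h2.toLp y := by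
      rw [← MemLp.toLp_add]
      exact Lp.ext (hu.trans (h1.add h2).coeFn_toLp.symm)
    rw [this, map_add, ihx h1.coeFn_toLp, ihy h2.coeFn_toLp]
  | smul c x hx ihx =>
    have h1 := memLp_of_continuous (continuous_of_mem_vpoly (n := M + 1) hx) (-τ) 0
    have : u = c • h1.toLp x := by
      rw [← MemLp.toLp_const_smul]
      exact Lp.ext (hu.trans (h1.const_smul c).coeFn_toLp.symm)
    rw [this, map_smul, ihx h1.coeFn_toLp]

theorem P_mem_vpoly (hτ : 0 < τ) (M : ℕ) (Φ : Fin (M + 1) → E d) : P τ M Φ ∈ vpoly d (M + 1) := by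
  refine sum_smul_mem_vpoly _ (fun i _ => ?_) Φ
  rw [degree_legendre (by linarith)]
  exact_mod_cast i.2

/-- Idempotence and self-adjointness give $\|\Pi\varphi\|^2=\langle\Pi\varphi,\varphi\rangle$, and
Cauchy–Schwarz finishes. -/
theorem norm_projOp_apply_le (hτ : 0 < τ) (M : ℕ) (φ : L2 d (-τ) 0) :
    ‖projOp d τ M φ‖ ≤ ‖φ‖ := by
  have h1 : projOp d τ M (projOp d τ M φ) = projOp d τ M φ :=
    projOp_of_mem_vpoly hτ (P_mem_vpoly hτ M _) (coeFn_projOp M φ)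
  have h2 : ‖projOp d τ M φ‖ ^ 2 ≤ ‖projOp d τ M φ‖ * ‖φ‖ := by
    rw [← real_inner_self_eq_norm_sq]
    nth_rw 2 [← adjoint_projOp]
    rw [adjoint_inner_right, h1]
    exact real_inner_le_norm _ _
  by_contra! hlt
  nlinarith [norm_nonneg φ]

theorem norm_projOp_le (hτ : 0 < τ) (M : ℕ) : ‖projOp d τ M‖ ≤ 1 :=
  opNorm_le_bound _ zero_le_one fun φ => by simpa using norm_projOp_apply_le hτ M φ

/-- Bounded continuous functions are dense in $L^2$, and Bernstein polynomials approximate them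
uniformly on the compact interval. -/
theorem exists_vpoly_near (hτ : 0 < τ) (φ : L2 d (-τ) 0) {ε : ℝ} (hε : 0 < ε) :
    ∃ n, ∃ p ∈ vpoly d n, ∃ u : L2 d (-τ) 0, u =ᵐ[volume.restrict (Icc (-τ) 0)] p ∧
      ‖φ - u‖ < ε := by
  have hab : -τ < 0 := by linarith
  obtain ⟨f, hf⟩ := Metric.denseRange_iff.1
    (BoundedContinuousFunction.toLp_denseRange (E d) (volume.restrict (Icc (-τ) 0)) ℝ
      (p := 2) (by norm_num)) φ (ε / 2) (by positivity)
  set δ := ε / (4 * √τ) with hδ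
  have hsτ : 0 < √τ := Real.sqrt_pos.2 hτ
  have hδ0 : 0 < δ := by positivity
  have huc : UniformContinuousOn f (Icc (-τ) 0) :=
    isCompact_Icc.uniformContinuousOn_of_continuous f.continuous.continuousOn
  obtain ⟨r, hr, hfr⟩ := Metric.uniformContinuousOn_iff.1 huc (δ / 2) (by positivity)
  -- Below distance $r$ uniform continuity suffices; from distance $r$ on, $\beta(x-y)^2$ exceeds
  -- the trivial bound $2\|f\|$.
  set β := 2 * ‖f‖ / r ^ 2 with hβ
  obtain ⟨n, hn⟩ := exists_nat_gt (β * (0 - -τ) ^ 2 / (δ / 2))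
  have hβ0 : 0 ≤ β := by positivity
  have hnR : (0 : ℝ) < n := lt_of_le_of_lt (by positivity) hn
  obtain ⟨p, hp, hfp⟩ := exists_vpoly_approx hab (n := n) (by exact_mod_cast hnR) (f := f)
    (α := δ / 2) hβ0 (fun x hx y hy => by
      rcases lt_or_ge (dist x y) r with h | h
      · have := hfr x hx y hy h
        rw [dist_eq_norm] at this
        have : 0 ≤ β * (x - y) ^ 2 := by positivity
        linarith
      · rw [Real.dist_eq] at h
        have h1 : r ^ 2 ≤ (x - y) ^ 2 := by
          rw [← sq_abs (x - y)]; exact pow_le_pow_left₀ hr.le h 2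
        have h2 : 2 * ‖f‖ ≤ β * (x - y) ^ 2 := by
          rw [hβ, div_mul_eq_mul_div, le_div_iff₀ (by positivity)]
          exact mul_le_mul_of_nonneg_left h1 (by positivity)
        have h3 := norm_sub_le (f x) (f y)
        have h4 := f.norm_coe_le_norm x
        have h5 := f.norm_coe_le_norm y
        linarith)
  have hb : δ / 2 + β * (0 - -τ) ^ 2 / n ≤ δ := by
    rw [div_lt_iff₀ (by positivity)] at hn
    have : β * (0 - -τ) ^ 2 / n ≤ δ / 2 := by
      rw [div_le_iff₀ hnR]; linarith
    linarith
  have hpL := memLp_of_continuous (continuous_of_mem_vpoly hp) (-τ) 0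
  refine ⟨n + 1, p, hp, hpL.toLp p, hpL.coeFn_toLp, ?_⟩
  set F' : L2 d (-τ) 0 := BoundedContinuousFunction.toLp 2 (volume.restrict (Icc (-τ) 0)) ℝ f
    with hF'
  have hF : F' =ᵐ[volume.restrict (Icc (-τ) 0)] f :=
    BoundedContinuousFunction.coeFn_toLp (p := 2) (volume.restrict (Icc (-τ) 0)) ℝ f
  have h1 : ‖F' - hpL.toLp p‖ ≤ δ * √τ := by
    have h2 : (F' - hpL.toLp p : L2 d (-τ) 0) =ᵐ[volume.restrict (Icc (-τ) 0)]
        fun t => f t - p t := by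
      filter_upwards [Lp.coeFn_sub F' (hpL.toLp p), hF, hpL.coeFn_toLp] with t e1 e2 e3
      rw [e1, Pi.sub_apply, e2, e3]
    rw [L2_norm_eq_sqrt h2]
    have hc : Continuous fun t => ‖f t - p t‖ ^ 2 :=
      (f.continuous.sub (continuous_of_mem_vpoly hp)).norm.pow 2
    have h3 : ∫ t in Icc (-τ) 0, ‖f t - p t‖ ^ 2 ≤ ∫ _ in Icc (-τ) 0, δ ^ 2 :=
      setIntegral_mono_on hc.continuousOn.integrableOn_Icc
        continuous_const.continuousOn.integrableOn_Icc measurableSet_Icc fun t ht =>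
          pow_le_pow_left₀ (norm_nonneg _) ((hfp t ht).trans hb) 2
    refine (Real.sqrt_le_sqrt h3).trans ?_
    rw [integral_const]
    have : (volume.restrict (Icc (-τ) 0)).real univ = τ := by simp [measureReal_def, hτ.le]
    rw [this, smul_eq_mul, Real.sqrt_mul hτ.le, Real.sqrt_sq hδ0.le, mul_comm]
  have h4 : δ * √τ = ε / 4 := by rw [hδ]; field_simp
  have h5 : ‖φ - F'‖ < ε / 2 := by rw [← dist_eq_norm]; exact hf
  calc ‖φ - hpL.toLp p‖ = ‖(φ - F') + (F' - hpL.toLp p)‖ := by congr 1; abel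
    _ ≤ _ := norm_add_le _ _
    _ < ε := by linarith

/-- The Legendre series converges in `L²`. -/
theorem tendsto_projOp_apply (hτ : 0 < τ) (φ : L2 d (-τ) 0) :
    Tendsto (fun M => projOp d τ M φ) atTop (𝓝 φ) := by
  rw [Metric.tendsto_atTop]
  intro ε hε
  obtain ⟨n, p, hp, u, hu, hφu⟩ := exists_vpoly_near hτ φ (half_pos hε)
  refine ⟨n, fun M hM => ?_⟩
  have h1 : projOp d τ M u = u := projOp_of_mem_vpoly hτ (vpoly_mono (by omega) hp) hu
  have h2 := norm_projOp_apply_le hτ M (φ - u)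
  rw [map_sub, h1] at h2
  rw [dist_eq_norm]
  calc ‖projOp d τ M φ - φ‖ = ‖(projOp d τ M φ - u) - (φ - u)‖ := by congr 1; abel
    _ ≤ _ := norm_sub_le _ _
    _ < ε := by linarith

/-- On a finite-dimensional domain, strong convergence on the basis vectors is already norm
convergence. -/
theorem tendsto_projOp_comp (hτ : 0 < τ) (k : E d →L[ℝ] L2 d (-τ) 0) :
    Tendsto (fun M => projOp d τ M ∘L k) atTop (𝓝 k) := by
  have h1 : ∀ k' : E d →L[ℝ] L2 d (-τ) 0, k' = ∑ j : Fin d,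
      (EuclideanSpace.proj j : E d →L[ℝ] ℝ).smulRight (k' (EuclideanSpace.single j 1)) := by
    intro k'
    ext1 v
    conv_lhs => rw [← (EuclideanSpace.basisFun (Fin d) ℝ).sum_repr v, map_sum]
    simp [sum_apply]
  have h2 : ∀ M, projOp d τ M ∘L k = ∑ j : Fin d, (EuclideanSpace.proj j : E d →L[ℝ] ℝ).smulRight
      (projOp d τ M (k (EuclideanSpace.single j 1))) := fun M => h1 _
  rw [h1 k]
  conv in fun M => _ => ext M; rw [← h1 k, h2 M]
  refine tendsto_finsetSum _ fun j _ => ?_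
  exact ((smulRightL ℝ (E d) (L2 d (-τ) 0) (EuclideanSpace.proj j)).continuous.tendsto _).comp
    (tendsto_projOp_apply hτ _)

/-- Taking adjoints, which is norm-continuous, turns this into the preceding case because the
projections are self-adjoint. -/
theorem tendsto_comp_projOp (hτ : 0 < τ) (k : L2 d (-τ) 0 →L[ℝ] E d) :
    Tendsto (fun M => k ∘L projOp d τ M) atTop (𝓝 k) := by
  have h1 := ((adjoint (𝕜 := ℝ) (E := E d) (F := L2 d (-τ) 0)).continuous.tendsto _).comp
    (tendsto_projOp_comp hτ (adjoint k))
  rw [adjoint_adjoint] at h1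
  refine h1.congr fun M => ?_
  rw [Function.comp_apply, adjoint_comp, adjoint_adjoint, adjoint_projOp]

/-- For fixed `N` the operator factors through finitely many point evaluations with values in
$\mathbb R^d$. -/
theorem tendsto_interpOp_comp_projOp (hτ : 0 < τ) {h : ℝ} (hh : 0 < h)
    {G : L2 d (-τ) 0 → ℝ → E d} (hb : BoundedIntoH1 h G) (hl : AELinear h G) (N : ℕ) :
    Tendsto (fun M => interpOp hh hb hl N ∘L projOp d τ M) atTop (𝓝 (interpOp hh hb hl N)) := by
  rw [interpOp_eq_sum]
  have h1 : ∀ M, (∑ x : nodes h N, polyOp d 0 h (Lagrange.basis (nodes h N) id (x : ℝ)) ∘L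
      evalOp hh hb hl ⟨x, Ioo_subset_Icc_self (nodes_subset hh x.2)⟩) ∘L projOp d τ M =
      ∑ x : nodes h N, polyOp d 0 h (Lagrange.basis (nodes h N) id (x : ℝ)) ∘L
        (evalOp hh hb hl ⟨x, Ioo_subset_Icc_self (nodes_subset hh x.2)⟩ ∘L projOp d τ M) := by
    intro M
    ext1 φ
    simp only [comp_apply, sum_apply]
  rw [funext h1]
  refine tendsto_finsetSum _ fun x _ => ?_
  exact ((continuous_const.clm_comp continuous_id).tendsto _).comp (tendsto_comp_projOp hτ _)

/-- An $\varepsilon/3$ argument: the operator is a norm limit of finite-rank interpolants, for which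
the claim is known, and the projections are contractions. -/
theorem tendsto_h1Op_comp_projOp (hτ : 0 < τ) {h : ℝ} (hh : 0 < h)
    {G : L2 d (-τ) 0 → ℝ → E d} (hb : BoundedIntoH1 h G) (hl : AELinear h G) :
    Tendsto (fun M => h1Op hb hl ∘L projOp d τ M) atTop (𝓝 (h1Op hb hl)) := by
  rw [Metric.tendsto_atTop]
  intro ε hε
  obtain ⟨N, hN⟩ := ((Metric.tendsto_nhds.1 (tendsto_interpOp hh hb hl)) (ε / 3)
    (by positivity)).exists
  obtain ⟨M₀, hM₀⟩ := Metric.tendsto_atTop.1 (tendsto_interpOp_comp_projOp hτ hh hb hl N) (ε / 3)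
    (by positivity)
  refine ⟨M₀, fun M hM => ?_⟩
  have h1 := hM₀ M hM
  rw [dist_eq_norm] at h1 hN ⊢
  set L := interpOp hh hb hl N
  have h2 : ‖(L - h1Op hb hl) ∘L projOp d τ M‖ ≤ ‖L - h1Op hb hl‖ :=
    (opNorm_comp_le _ _).trans (mul_le_of_le_one_right (norm_nonneg _) (norm_projOp_le hτ M))
  have h3 : h1Op hb hl ∘L projOp d τ M - h1Op hb hl = -((L - h1Op hb hl) ∘L projOp d τ M) +
      (L ∘L projOp d τ M - L) + (L - h1Op hb hl) := by
    rw [ContinuousLinearMap.sub_comp]; abel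
  rw [h3]
  refine (norm_add₃_le).trans_lt ?_
  rw [norm_neg]
  linarith

end Projection


/-! ### The delay operator `𝓕` -/

section Delay

variable {d : ℕ} {C : ℝ → ℝ → Matrix (Fin d) (Fin d) ℝ} {τ s h K : ℝ}

theorem norm_le_sum_abs (v : E d) : ‖v‖ ≤ ∑ i, |v i| := by
  rw [EuclideanSpace.norm_eq]
  refine (Real.sqrt_le_sqrt (Finset.sum_sq_le_sq_sum_of_nonneg fun i _ => norm_nonneg _)).trans ?_
  rw [Real.sqrt_sq (Finset.sum_nonneg fun i _ => norm_nonneg _)]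
  simp

theorem toEuclideanLin_apply_apply (A : Matrix (Fin d) (Fin d) ℝ) (v : E d) (i : Fin d) :
    Matrix.toEuclideanLin A v i = ∑ j, A i j * v j := by
  simp [Matrix.toLpLin_apply, Matrix.mulVec, dotProduct]

theorem norm_toEuclideanLin_le (A : Matrix (Fin d) (Fin d) ℝ) (v : E d) :
    ‖Matrix.toEuclideanLin A v‖ ≤ (∑ i, ∑ j, |A i j|) * ‖v‖ := by
  refine (norm_le_sum_abs _).trans ?_
  rw [Finset.sum_mul]
  refine Finset.sum_le_sum fun i _ => ?_
  rw [toEuclideanLin_apply_apply, Finset.sum_mul]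
  refine (Finset.abs_sum_le_sum_abs _ _).trans (Finset.sum_le_sum fun j _ => ?_)
  rw [abs_mul]
  exact mul_le_mul_of_nonneg_left (PiLp.norm_apply_le v j) (abs_nonneg _)

/-- The slice `C(r, ·)` is measurable and bounded by `K`. -/
structure SliceBound (C : ℝ → ℝ → Matrix (Fin d) (Fin d) ℝ) (τ K r : ℝ) : Prop where
  meas : ∀ i j, AEStronglyMeasurable (fun θ => C r θ i j) (volume.restrict (Icc (-τ) 0))
  bound : ∀ᵐ θ ∂(volume.restrict (Icc (-τ) 0)), ∀ v : E d,
    ‖Matrix.toEuclideanLin (C r θ) v‖ ≤ K * ‖v‖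

/-- Fubini for null sets applied entrywise; `K` is the sum of the essential suprema of the entries.
-/
theorem exists_ae_sliceBound {a b : ℝ} (H : KernelLInfty C τ a b) :
    ∃ K, 0 ≤ K ∧ ∀ᵐ r ∂(volume.restrict (Icc a b)), SliceBound C τ K r := by
  set c : Fin d → Fin d → ℝ := fun i j => (eLpNorm (fun p : ℝ × ℝ => C p.1 p.2 i j) ⊤
    (volume.restrict (Icc a b ×ˢ Icc (-τ) 0))).toReal with hc
  have hprod : (volume.restrict (Icc a b ×ˢ Icc (-τ) 0) : Measure (ℝ × ℝ)) =
      (volume.restrict (Icc a b)).prod (volume.restrict (Icc (-τ) 0)) := by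
    rw [Measure.prod_restrict, Measure.volume_eq_prod]
  have h1 : ∀ i j, ∀ᵐ r ∂(volume.restrict (Icc a b)),
      AEStronglyMeasurable (fun θ => C r θ i j) (volume.restrict (Icc (-τ) 0)) := by
    intro i j
    have := (H i j).1
    rw [hprod] at this
    exact this.prodMk_left
  have h2 : ∀ i j, ∀ᵐ r ∂(volume.restrict (Icc a b)), ∀ᵐ θ ∂(volume.restrict (Icc (-τ) 0)),
      |C r θ i j| ≤ c i j := by
    intro i j
    have h3 : ∀ᵐ p ∂(volume.restrict (Icc a b ×ˢ Icc (-τ) 0) : Measure (ℝ × ℝ)),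
        |C p.1 p.2 i j| ≤ c i j := by
      filter_upwards [ae_le_eLpNormEssSup (f := fun p : ℝ × ℝ => C p.1 p.2 i j)
        (μ := volume.restrict (Icc a b ×ˢ Icc (-τ) 0))] with p hp
      have hfin := (H i j).2.ne
      rw [← eLpNorm_exponent_top] at hp
      have := ENNReal.toReal_mono hfin hp
      rwa [toReal_enorm, Real.norm_eq_abs] at this
    rw [hprod] at h3
    exact Measure.ae_ae_of_ae_prod h3
  refine ⟨∑ i, ∑ j, c i j, Finset.sum_nonneg fun i _ => Finset.sum_nonneg fun j _ =>
    ENNReal.toReal_nonneg, ?_⟩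
  filter_upwards [ae_all_iff.2 fun i => ae_all_iff.2 fun j => h1 i j,
    ae_all_iff.2 fun i => ae_all_iff.2 fun j => h2 i j] with r hr1 hr2
  refine ⟨hr1, ?_⟩
  filter_upwards [ae_all_iff.2 fun i => ae_all_iff.2 fun j => hr2 i j] with θ hθ v
  exact (norm_toEuclideanLin_le _ _).trans (mul_le_mul_of_nonneg_right
    (Finset.sum_le_sum fun i _ => Finset.sum_le_sum fun j _ => hθ i j) (norm_nonneg v))

theorem measurePreserving_shift (c a b : ℝ) : MeasurePreserving (fun x => c + x)
    (volume.restrict (Icc a b)) (volume.restrict (Icc (c + a) (c + b))) := by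
  have h := (measurePreserving_add_left volume c).restrict_preimage
    (measurableSet_Icc (a := c + a) (b := c + b))
  rwa [preimage_const_add_Icc, add_sub_cancel_left, add_sub_cancel_left] at h

theorem measurePreserving_shift_delay (τ t : ℝ) : MeasurePreserving (fun x => t + x)
    (volume.restrict (Icc (-τ) 0)) (volume.restrict (Icc (t - τ) t)) := by
  simpa [sub_eq_add_neg] using measurePreserving_shift t (-τ) 0

theorem Icc_delay_subset {t : ℝ} (ht : t ∈ Icc 0 h) : Icc (t - τ) t ⊆ Icc (-τ) h :=
  Icc_subset_Icc (by linarith [ht.1]) ht.2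

theorem memLp_delay {v : ℝ → E d} (hv : MemLp v 2 (volume.restrict (Icc (-τ) h))) {t : ℝ}
    (ht : t ∈ Icc 0 h) : MemLp (fun θ => v (t + θ)) 2 (volume.restrict (Icc (-τ) 0)) :=
  (hv.mono_measure (Measure.restrict_mono (Icc_delay_subset ht) le_rfl)).comp_measurePreserving
    (measurePreserving_shift_delay τ t)

theorem SliceBound.integrable {t : ℝ} (hC : SliceBound C τ K (s + t)) {v : ℝ → E d}
    (hv : MemLp v 2 (volume.restrict (Icc (-τ) h))) (ht : t ∈ Icc 0 h) :
    Integrable (fun θ => Matrix.toEuclideanLin (C (s + t) θ) (v (t + θ)))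
      (volume.restrict (Icc (-τ) 0)) := by
  have hv' := memLp_delay hv ht
  have hm : AEStronglyMeasurable (fun θ => Matrix.toEuclideanLin (C (s + t) θ) (v (t + θ)))
      (volume.restrict (Icc (-τ) 0)) := by
    have h1 : (fun θ => Matrix.toEuclideanLin (C (s + t) θ) (v (t + θ))) = fun θ =>
        ∑ i, (∑ j, C (s + t) θ i j * v (t + θ) j) • EuclideanSpace.single i (1 : ℝ) := by
      ext1 θ
      rw [← (EuclideanSpace.basisFun (Fin d) ℝ).sum_repr
        (Matrix.toEuclideanLin (C (s + t) θ) (v (t + θ)))]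
      simp [toEuclideanLin_apply_apply]
    rw [h1]
    refine Finset.aestronglyMeasurable_fun_sum _ fun i _ => AEStronglyMeasurable.smul_const ?_ _
    refine Finset.aestronglyMeasurable_fun_sum _ fun j _ => (hC.meas i j).mul ?_
    exact (EuclideanSpace.proj j : E d →L[ℝ] ℝ).continuous.comp_aestronglyMeasurable hv'.1
  refine ((hv'.integrable one_le_two).norm.const_mul K).mono' hm ?_
  filter_upwards [hC.bound] with θ hθ using hθ _

/-- Translation preserves null sets, so this holds at every $t\in[0,h]$ with no assumption on the
kernel. -/
theorem F_congr {v v' : ℝ → E d} (hv : v =ᵐ[volume.restrict (Icc (-τ) h)] v') {t : ℝ}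
    (ht : t ∈ Icc 0 h) : F C τ s v t = F C τ s v' t := by
  have h1 : ∀ᵐ u ∂(volume.restrict (Icc (t - τ) t)), v u = v' u :=
    ae_restrict_of_ae_restrict_of_subset (Icc_delay_subset ht) hv
  refine integral_congr_ae ?_
  filter_upwards [(measurePreserving_shift_delay τ t).quasiMeasurePreserving.ae h1] with θ hθ
  simp only [hθ]

theorem SliceBound.F_add {t : ℝ} (hC : SliceBound C τ K (s + t)) {v v' : ℝ → E d}
    (hv : MemLp v 2 (volume.restrict (Icc (-τ) h)))
    (hv' : MemLp v' 2 (volume.restrict (Icc (-τ) h))) (ht : t ∈ Icc 0 h) :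
    F C τ s (v + v') t = F C τ s v t + F C τ s v' t := by
  simp only [F, Pi.add_apply, map_add]
  exact integral_add (hC.integrable hv ht) (hC.integrable hv' ht)

theorem F_smul (c : ℝ) (v : ℝ → E d) : F C τ s (c • v) = c • F C τ s v := by
  ext1 t
  simp only [F, Pi.smul_apply, map_smul]
  exact integral_smul _ _

theorem V_add (φ φ' w w' : ℝ → E d) : V (φ + φ') (w + w') = V φ w + V φ' w' := by
  ext1 t; by_cases ht : 0 < t <;> simp [V, ht]

theorem V_smul (c : ℝ) (φ w : ℝ → E d) : V (c • φ) (c • w) = c • V φ w := by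
  ext1 t; by_cases ht : 0 < t <;> simp [V, ht]

theorem ae_restrict_delay {p : ℝ → Prop}
    (h1 : ∀ᵐ t ∂(volume.restrict (Icc (-τ) 0)), t ≤ 0 → p t)
    (h2 : ∀ᵐ t ∂(volume.restrict (Icc 0 h)), 0 < t → p t) :
    ∀ᵐ t ∂(volume.restrict (Icc (-τ) h)), p t := by
  rw [ae_restrict_iff' measurableSet_Icc] at h1 h2 ⊢
  filter_upwards [h1, h2] with t ht1 ht2 ht
  rcases le_or_gt t 0 with h0 | h0
  · exact ht1 ⟨ht.1, h0⟩ h0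
  · exact ht2 ⟨h0.le, ht.2⟩ h0

theorem V_congr {φ φ' w w' : ℝ → E d} (hφ : φ =ᵐ[volume.restrict (Icc (-τ) 0)] φ')
    (hw : w =ᵐ[volume.restrict (Icc 0 h)] w') :
    V φ w =ᵐ[volume.restrict (Icc (-τ) h)] V φ' w' := by
  refine ae_restrict_delay ?_ ?_
  · filter_upwards [hφ] with t ht h0
    simp [V, not_lt.2 h0, ht]
  · filter_upwards [hw] with t ht h0
    simp [V, h0, ht]

theorem memLp_V {φ w : ℝ → E d} (hφ : MemLp φ 2 (volume.restrict (Icc (-τ) 0)))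
    (hw : MemLp w 2 (volume.restrict (Icc 0 h))) :
    MemLp (V φ w) 2 (volume.restrict (Icc (-τ) h)) := by
  have h1 : V φ w = (Ioi 0).indicator w + (Iic 0).indicator φ := by
    ext1 t; by_cases ht : 0 < t <;> simp [V, ht, indicator, not_le, not_lt.1]
  rw [h1]
  refine MemLp.add ?_ ?_
  · rw [memLp_indicator_iff_restrict measurableSet_Ioi, Measure.restrict_restrict measurableSet_Ioi]
    refine hw.mono_measure (Measure.restrict_mono ?_ le_rfl)
    exact fun t ht => ⟨(mem_Ioi.1 ht.1).le, ht.2.2⟩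
  · rw [memLp_indicator_iff_restrict measurableSet_Iic, Measure.restrict_restrict measurableSet_Iic]
    refine hφ.mono_measure (Measure.restrict_mono ?_ le_rfl)
    exact fun t ht => ⟨ht.2.1, ht.1⟩

/-- The slices `C(s + t, ·)`, `0 ≤ t ≤ h`, are measurable and uniformly bounded up to a null set. -/
def KernelBound (C : ℝ → ℝ → Matrix (Fin d) (Fin d) ℝ) (τ s h K : ℝ) : Prop :=
  ∀ᵐ t ∂(volume.restrict (Icc 0 h)), SliceBound C τ K (s + t)

theorem exists_kernelBound (H : KernelLInfty C τ s (s + h)) : ∃ K, 0 ≤ K ∧ KernelBound C τ s h K := by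
  obtain ⟨K, hK, hC⟩ := exists_ae_sliceBound H
  have := measurePreserving_shift s 0 h
  rw [add_zero] at this
  exact ⟨K, hK, this.quasiMeasurePreserving.ae hC⟩

theorem KernelBound.F_V_add (hC : KernelBound C τ s h K) {φ φ' w w' : ℝ → E d}
    (hφ : MemLp φ 2 (volume.restrict (Icc (-τ) 0))) (hφ' : MemLp φ' 2 (volume.restrict (Icc (-τ) 0)))
    (hw : MemLp w 2 (volume.restrict (Icc 0 h))) (hw' : MemLp w' 2 (volume.restrict (Icc 0 h))) :
    F C τ s (V (φ + φ') (w + w')) =ᵐ[volume.restrict (Icc 0 h)]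
      F C τ s (V φ w) + F C τ s (V φ' w') := by
  filter_upwards [hC, ae_restrict_mem measurableSet_Icc] with t ht hmem
  rw [V_add]
  exact ht.F_add (memLp_V hφ hw) (memLp_V hφ' hw') hmem

theorem F_V_congr {φ φ' w w' : ℝ → E d} (hφ : φ =ᵐ[volume.restrict (Icc (-τ) 0)] φ')
    (hw : w =ᵐ[volume.restrict (Icc 0 h)] w') :
    F C τ s (V φ w) =ᵐ[volume.restrict (Icc 0 h)] F C τ s (V φ' w') := by
  filter_upwards [ae_restrict_mem measurableSet_Icc] with t ht
  exact F_congr (V_congr hφ hw) ht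

theorem KernelBound.aelinear_FVplus (hC : KernelBound C τ s h K) :
    AELinear h (FVplus C τ s h) where
  map_add a b := by
    refine (F_V_congr (EventuallyEq.rfl (f := (0 : ℝ → E d))) (Lp.coeFn_add a b)).trans ?_
    have := hC.F_V_add (φ := 0) (φ' := 0) MemLp.zero MemLp.zero (Lp.memLp a) (Lp.memLp b)
    rwa [add_zero] at this
  map_smul c a := by
    refine (F_V_congr (EventuallyEq.rfl (f := (0 : ℝ → E d))) (Lp.coeFn_smul c a)).trans ?_
    have := V_smul c (0 : ℝ → E d) a
    rw [smul_zero] at this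
    rw [this, F_smul]
    rfl

theorem KernelBound.aelinear_FVminus (hC : KernelBound C τ s h K) :
    AELinear h (FVminus C τ s) where
  map_add a b := by
    refine (F_V_congr (Lp.coeFn_add a b) (EventuallyEq.rfl (f := (0 : ℝ → E d)))).trans ?_
    have := hC.F_V_add (w := 0) (w' := 0) (Lp.memLp a) (Lp.memLp b) MemLp.zero MemLp.zero
    rwa [add_zero] at this
  map_smul c a := by
    refine (F_V_congr (Lp.coeFn_smul c a) (EventuallyEq.rfl (f := (0 : ℝ → E d)))).trans ?_
    have := V_smul c a (0 : ℝ → E d)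
    rw [smul_zero] at this
    rw [this, F_smul]
    rfl

/-- The Volterra property: $V(0,w)$ vanishes at nonpositive times, so only the values of $w$ on
$(0,t]$ enter. -/
theorem SliceBound.norm_F_V_zero_le (hK : 0 ≤ K) {t : ℝ} (hC : SliceBound C τ K (s + t))
    {w : ℝ → E d} (hw : MemLp w 2 (volume.restrict (Icc 0 h))) (ht : t ∈ Icc 0 h) :
    ‖F C τ s (V 0 w) t‖ ≤ K * ∫ u in Icc 0 t, ‖w u‖ := by
  have hV : MemLp (V 0 w) 2 (volume.restrict (Icc (-τ) h)) := memLp_V MemLp.zero hw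
  have hd := ((memLp_delay hV ht).integrable one_le_two).norm
  have h1 : ‖F C τ s (V 0 w) t‖ ≤ ∫ θ in Icc (-τ) 0, K * ‖V 0 w (t + θ)‖ :=
    norm_integral_le_of_norm_le (hd.const_mul K) (hC.bound.mono fun θ hθ => hθ _)
  rw [integral_const_mul] at h1
  refine h1.trans (mul_le_mul_of_nonneg_left ?_ hK)
  rw [(measurePreserving_shift_delay τ t).integral_comp
    (measurableEmbedding_addLeft t) fun u => ‖V 0 w u‖]
  have h2 : (fun u => ‖V 0 w u‖) = (Ioi 0).indicator fun u => ‖w u‖ := by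
    ext1 u; by_cases hu : 0 < u <;> simp [V, hu, indicator]
  rw [h2, integral_indicator measurableSet_Ioi, Measure.restrict_restrict measurableSet_Ioi]
  refine setIntegral_mono_set ?_ (Eventually.of_forall fun u => norm_nonneg _)
    (LE.le.eventuallyLE fun u hu => ⟨(mem_Ioi.1 hu.1).le, hu.2.2⟩)
  exact ((hw.integrable one_le_two).mono_measure
    (Measure.restrict_mono (Icc_subset_Icc_right ht.2) le_rfl)).norm

end Delay

/-! ### Volterra operators -/

section Volterra

variable {d : ℕ} {h K : ℝ} {A : L2 d 0 h →L[ℝ] L2 d 0 h}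

/-- One application trades the $L^1$ norm for a pointwise bound; each further one integrates
$u^n/n!$ over $[0,t]$, producing the next factorial. -/
theorem norm_volterra_pow_le (hK : 0 ≤ K)
    (hA : ∀ w : L2 d 0 h, ∀ᵐ t ∂(volume.restrict (Icc 0 h)),
      ‖A w t‖ ≤ K * ∫ u in Icc 0 t, ‖w u‖) (w : L2 d 0 h) (n : ℕ) :
    ∀ᵐ t ∂(volume.restrict (Icc 0 h)), ‖(A ^ (n + 1)) w t‖ ≤
      K ^ (n + 1) * (t ^ n / n.factorial) * ∫ u in Icc 0 h, ‖w u‖ := by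
  have hint : ∀ w : L2 d 0 h, IntegrableOn (fun u => ‖w u‖) (Icc 0 h) := fun w =>
    ((Lp.memLp w).integrable one_le_two).norm
  set L := ∫ u in Icc 0 h, ‖w u‖ with hL
  induction n with
  | zero =>
    filter_upwards [hA w, ae_restrict_mem measurableSet_Icc] with t ht hmem
    simp only [zero_add, pow_one, pow_zero, Nat.factorial_zero, Nat.cast_one, div_one, mul_one]
    refine ht.trans (mul_le_mul_of_nonneg_left ?_ hK)
    exact setIntegral_mono_set (hint w) (Eventually.of_forall fun u => norm_nonneg _)
      (Icc_subset_Icc_right hmem.2).eventuallyLE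
  | succ n ih =>
    filter_upwards [hA ((A ^ (n + 1)) w), ae_restrict_mem measurableSet_Icc] with t ht hmem
    rw [pow_succ' A]
    refine (ht.trans (mul_le_mul_of_nonneg_left (integral_mono_ae
      ((hint _).mono_set (Icc_subset_Icc_right hmem.2)) (g := fun u =>
      K ^ (n + 1) * (u ^ n / n.factorial) * L) ?_ ?_) hK)).trans (le_of_eq ?_)
    · exact (by fun_prop : Continuous fun u : ℝ => K ^ (n + 1) * (u ^ n / n.factorial) * L)
        |>.continuousOn.integrableOn_Icc
    · exact ae_restrict_of_ae_restrict_of_subset (Icc_subset_Icc_right hmem.2) ih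
    · rw [integral_mul_const, integral_const_mul, integral_div, integral_Icc_eq_integral_Ioc,
        ← intervalIntegral.integral_of_le hmem.1, integral_pow, Nat.factorial_succ]
      push_cast
      field_simp
      ring

/-- The resolvent of a Volterra operator. -/
theorem isUnit_one_sub_volterra (hh : 0 < h) (hK : 0 ≤ K)
    (hA : ∀ w : L2 d 0 h, ∀ᵐ t ∂(volume.restrict (Icc 0 h)),
      ‖A w t‖ ≤ K * ∫ u in Icc 0 t, ‖w u‖) : IsUnit (1 - A) := by
  have hvol : (volume.restrict (Icc 0 h)).real univ = h := by simp [measureReal_def, hh.le]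
  have hnorm : ∀ n : ℕ, ‖A ^ (n + 1)‖ ≤ K * h * ((K * h) ^ n / n.factorial) := by
    intro n
    refine ContinuousLinearMap.opNorm_le_bound _ (by positivity) fun w => ?_
    set L := ∫ u in Icc 0 h, ‖w u‖ with hL
    have hL0 : 0 ≤ L := integral_nonneg fun u => norm_nonneg _
    set B := K ^ (n + 1) * (h ^ n / n.factorial) * L with hB
    have h1 : ‖(A ^ (n + 1)) w‖ ≤ √h * B := by
      rw [L2_norm_eq_sqrt EventuallyEq.rfl]
      have : ∫ t in Icc 0 h, ‖(A ^ (n + 1)) w t‖ ^ 2 ≤ ∫ _ in Icc 0 h, B ^ 2 := by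
        refine integral_mono_ae ((Lp.memLp _).integrable_norm_pow (by norm_num))
          (integrable_const _) ?_
        filter_upwards [norm_volterra_pow_le hK hA w n, ae_restrict_mem measurableSet_Icc]
          with t ht hmem
        refine pow_le_pow_left₀ (norm_nonneg _) (ht.trans ?_) 2
        have := hmem.1
        have := hmem.2
        rw [hB]
        gcongr
      refine (Real.sqrt_le_sqrt this).trans (le_of_eq ?_)
      rw [integral_const, hvol, smul_eq_mul, Real.sqrt_mul hh.le, Real.sqrt_sq (by positivity)]
    have h2 : L ≤ √h * ‖w‖ := by
      have := sq_integral_norm_le (Lp.memLp w)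
      rw [hvol, ← L2_norm_sq] at this
      refine (Real.le_sqrt_of_sq_le this).trans (le_of_eq ?_)
      rw [Real.sqrt_mul hh.le, Real.sqrt_sq (norm_nonneg _)]
    calc _ ≤ √h * B := h1
      _ ≤ √h * (K ^ (n + 1) * (h ^ n / n.factorial) * (√h * ‖w‖)) := by rw [hB]; gcongr
      _ = (√h * √h) * (K ^ (n + 1) * (h ^ n / n.factorial) * ‖w‖) := by ring
      _ = _ := by rw [Real.mul_self_sqrt hh.le, mul_pow]; ring
  have hlim : Tendsto (fun n : ℕ => K * h * ((K * h) ^ n / n.factorial)) atTop (𝓝 0) := by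
    simpa using (FloorSemiring.tendsto_pow_div_factorial_atTop (K * h)).const_mul (K * h)
  obtain ⟨n, hn⟩ := (hlim.eventually_lt_const one_pos).exists
  have hu : IsUnit (1 - A ^ (n + 1)) := isUnit_one_sub_of_norm_lt_one ((hnorm n).trans_lt hn)
  -- A power of `A` has norm below one, so $1-A^{n+1}$ is a unit; $1-A$ is one of two commuting
  -- factors of it.
  rw [← mul_neg_geom_sum] at hu
  refine ((Commute.isUnit_mul_iff ?_).1 hu).1
  exact (Commute.sum_right _ _ _ fun i _ => (Commute.one_left _).sub_left
    ((Commute.refl A).pow_right i))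

end Volterra


/-! ### The segment map -/

section Segment

variable {d : ℕ} {τ h : ℝ}

theorem ae_segment (hτh : τ ≤ h) {p : ℝ → Prop} (hp : ∀ᵐ t ∂(volume.restrict (Icc 0 h)), p t) :
    ∀ᵐ θ ∂(volume.restrict (Icc (-τ) 0)), p (h + θ) :=
  (measurePreserving_shift_delay τ h).quasiMeasurePreserving.ae
    (ae_restrict_of_ae_restrict_of_subset (Icc_subset_Icc_left (by linarith)) hp)

theorem memLp_segment (hτh : τ ≤ h) {w : ℝ → E d} (hw : MemLp w 2 (volume.restrict (Icc 0 h))) :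
    MemLp (fun θ => w (h + θ)) 2 (volume.restrict (Icc (-τ) 0)) :=
  (hw.mono_measure (Measure.restrict_mono (Icc_subset_Icc_left (by linarith))
    le_rfl)).comp_measurePreserving (measurePreserving_shift_delay τ h)

/-- The segment `w_h` of a function on `[0,h]`, as a map from `L²([0,h])` to `L²([-τ,0])`. -/
def segmentOp (d : ℕ) (hτh : τ ≤ h) : L2 d 0 h →L[ℝ] L2 d (-τ) 0 :=
  LinearMap.mkContinuous
    { toFun := fun w => (memLp_segment hτh (Lp.memLp w)).toLp _
      map_add' := fun v w => by
        rw [← MemLp.toLp_add]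
        exact MemLp.toLp_congr _ _ (ae_segment hτh (Lp.coeFn_add v w))
      map_smul' := fun c w => by
        rw [RingHom.id_apply, ← MemLp.toLp_const_smul]
        exact MemLp.toLp_congr _ _ (ae_segment hτh (Lp.coeFn_smul c w)) } 1 (fun w => by
      change ‖(memLp_segment hτh (Lp.memLp w)).toLp _‖ ≤ _
      rw [L2_norm_eq_sqrt (memLp_segment hτh (Lp.memLp w)).coeFn_toLp, one_mul,
        L2_norm_eq_sqrt (EventuallyEq.refl _ w), (measurePreserving_shift_delay τ h).integral_comp
          (measurableEmbedding_addLeft h) fun u => ‖w u‖ ^ 2]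
      exact Real.sqrt_le_sqrt (setIntegral_mono_set ((Lp.memLp w).integrable_norm_pow (by norm_num))
        (Eventually.of_forall fun t => sq_nonneg _)
        (Icc_subset_Icc_left (by linarith : 0 ≤ h - τ)).eventuallyLE))

theorem coeFn_segmentOp (hτh : τ ≤ h) {w : L2 d 0 h} {f : ℝ → E d}
    (hf : w =ᵐ[volume.restrict (Icc 0 h)] f) :
    segmentOp d hτh w =ᵐ[volume.restrict (Icc (-τ) 0)] fun θ => f (h + θ) :=
  (memLp_segment hτh (Lp.memLp w)).coeFn_toLp.trans (ae_segment hτh hf)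

end Segment

/-! ### The initial value problem -/

section InitialValueProblem

variable {d : ℕ} {C : ℝ → ℝ → Matrix (Fin d) (Fin d) ℝ} {τ s h K : ℝ}

theorem KernelBound.F_V_split (hC : KernelBound C τ s h K) (φ : L2 d (-τ) 0) (w : L2 d 0 h) :
    F C τ s (V φ w) =ᵐ[volume.restrict (Icc 0 h)] FVminus C τ s φ + FVplus C τ s h w := by
  have := hC.F_V_add (φ := φ) (φ' := 0) (w := 0) (w' := w) (Lp.memLp φ) MemLp.zero MemLp.zero
    (Lp.memLp w)
  rwa [add_zero, zero_add] at this

variable (hC : KernelBound C τ s h K) (H2 : BoundedIntoH1 h (FVplus C τ s h))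
  (H3 : BoundedIntoH1 h (FVminus C τ s))

/-- The operator `𝓕 V⁺` on `L²([0,h])`. -/
def plusOp : L2 d 0 h →L[ℝ] L2 d 0 h := h1Op H2 hC.aelinear_FVplus

/-- The operator `𝓕 V⁻` from `L²([-τ,0])` to `L²([0,h])`. -/
def minusOp : L2 d (-τ) 0 →L[ℝ] L2 d 0 h := h1Op H3 hC.aelinear_FVminus

theorem isUnit_one_sub_plusOp (hh : 0 < h) (hK : 0 ≤ K) : IsUnit (1 - plusOp hC H2) := by
  refine isUnit_one_sub_volterra hh hK fun w => ?_
  filter_upwards [coeFn_h1Op H2 hC.aelinear_FVplus w, hC, ae_restrict_mem measurableSet_Icc]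
    with t h1 h2 hmem
  change ‖h1Op H2 hC.aelinear_FVplus w t‖ ≤ _
  rw [h1]
  exact h2.norm_F_V_zero_le hK (Lp.memLp w) hmem

theorem eq_plusOp_add_minusOp_iff (φ : L2 d (-τ) 0) (w : L2 d 0 h) :
    w = plusOp hC H2 w + minusOp hC H3 φ ↔
      w =ᵐ[volume.restrict (Icc 0 h)] F C τ s (V φ w) := by
  have h1 : ((plusOp hC H2 w + minusOp hC H3 φ : L2 d 0 h) : ℝ → E d)
      =ᵐ[volume.restrict (Icc 0 h)] F C τ s (V φ w) := by
    refine (Lp.coeFn_add _ _).trans (EventuallyEq.trans ?_ (hC.F_V_split φ w).symm)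
    rw [add_comm]
    exact (coeFn_h1Op H3 hC.aelinear_FVminus φ).add (coeFn_h1Op H2 hC.aelinear_FVplus w)
  constructor
  · intro h
    rw [← h] at h1
    exact h1
  · exact fun h => Lp.ext (h.trans h1.symm)

theorem renewalRHS_eq_F (x : ℝ → E d) (t : ℝ) :
    renewalRHS C τ (s + t) x = F C τ s (fun u => x (s + u)) t := by
  simp only [renewalRHS, F, add_assoc]

theorem measurePreserving_unshift (s a b : ℝ) : MeasurePreserving (fun r => -s + r)
    (volume.restrict (Icc (s + a) (s + b))) (volume.restrict (Icc a b)) := by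
  simpa using measurePreserving_shift (-s) (s + a) (s + b)

theorem isSolution_of_fixed {φ : L2 d (-τ) 0} {w : L2 d 0 h}
    (hw : w =ᵐ[volume.restrict (Icc 0 h)] F C τ s (V φ w)) :
    IsSolution C τ s (s + h) φ fun r => V φ w (-s + r) where
  memLp := by
    rw [sub_eq_add_neg]
    exact (memLp_V (Lp.memLp φ) (Lp.memLp w)).comp_measurePreserving
      (measurePreserving_unshift s (-τ) h)
  initial := by
    filter_upwards [ae_restrict_mem measurableSet_Icc] with θ hθ
    simp [V, not_lt.2 hθ.2]
  equation := by
    have h1 := (measurePreserving_unshift s 0 h).quasiMeasurePreserving.ae hw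
    rw [add_zero] at h1
    filter_upwards [ae_restrict_of_ae_restrict_of_subset Ioc_subset_Icc_self h1,
      ae_restrict_mem measurableSet_Ioc] with r hr hmem
    have h2 := renewalRHS_eq_F (C := C) (τ := τ) (s := s) (fun r => V φ w (-s + r)) (-s + r)
    simp only [add_neg_cancel_left, neg_add_cancel_left] at h2
    have h3 : 0 < -s + r := by linarith [hmem.1]
    rw [h2, ← hr]
    simp [V, h3]

/-- Converse to `isSolution_of_fixed`: every solution comes from a fixed point on $[0,h]$, so
uniqueness of fixed points gives uniqueness of solutions. -/
theorem IsSolution.exists_fixed (hτ : 0 < τ) {φ : L2 d (-τ) 0} {y : ℝ → E d}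
    (hy : IsSolution C τ s (s + h) φ y) : ∃ w : L2 d 0 h,
      w =ᵐ[volume.restrict (Icc 0 h)] F C τ s (V φ w) ∧
      (w =ᵐ[volume.restrict (Icc 0 h)] fun t => y (s + t)) ∧
      ∀ᵐ r ∂(volume.restrict (Icc (s - τ) (s + h))), y r = V φ w (-s + r) := by
  have h0 := hy.memLp
  rw [sub_eq_add_neg] at h0
  have h1 : MemLp (fun t => y (s + t)) 2 (volume.restrict (Icc (-τ) h)) :=
    h0.comp_measurePreserving (measurePreserving_shift s (-τ) h)
  have h2 : MemLp (fun t => y (s + t)) 2 (volume.restrict (Icc 0 h)) :=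
    h1.mono_measure (Measure.restrict_mono (Icc_subset_Icc_left (by linarith)) le_rfl)
  set w : L2 d 0 h := h2.toLp _ with hw
  have hwy : w =ᵐ[volume.restrict (Icc 0 h)] fun t => y (s + t) := h2.coeFn_toLp
  have h3 : (fun t => y (s + t)) =ᵐ[volume.restrict (Icc (-τ) h)] V φ w := by
    refine ae_restrict_delay ?_ ?_
    · filter_upwards [hy.initial] with t ht h0
      simp [V, not_lt.2 h0, ht]
    · filter_upwards [hwy] with t ht h0
      simp [V, h0, ht]
  refine ⟨w, ?_, hwy, ?_⟩
  · have h4 := hy.equation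
    rw [Measure.restrict_congr_set Ioc_ae_eq_Icc] at h4
    have h5 := measurePreserving_shift s 0 h
    rw [add_zero] at h5
    filter_upwards [h5.quasiMeasurePreserving.ae h4, hwy, ae_restrict_mem measurableSet_Icc]
      with t e1 e2 hmem
    rw [e2, e1, renewalRHS_eq_F, F_congr h3 hmem]
  · rw [sub_eq_add_neg]
    filter_upwards [(measurePreserving_unshift s (-τ) h).quasiMeasurePreserving.ae h3] with r hr
    rw [← hr, add_neg_cancel_left]

theorem eq_inverse_apply {Y : Type*} [NormedAddCommGroup Y] [NormedSpace ℝ Y] {A : Y →L[ℝ] Y}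
    (hA : IsUnit (1 - A)) {w b : Y} : w = A w + b ↔ w = Ring.inverse (1 - A) b := by
  have h1 : ∀ v, Ring.inverse (1 - A) ((1 - A) v) = v := fun v => by
    rw [← mul_apply_eq_comp, Ring.inverse_mul_cancel _ hA,
      one_apply_eq_self]
  have h2 : ∀ v, (1 - A) (Ring.inverse (1 - A) v) = v := fun v => by
    rw [← mul_apply_eq_comp, Ring.mul_inverse_cancel _ hA,
      one_apply_eq_self]
  have h3 : ∀ v, (1 - A) v = v - A v := fun v => rfl
  constructor
  · intro h
    have : (1 - A) w = b := by rw [h3, sub_eq_iff_eq_add']; exact h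
    rw [← this, h1]
  · rintro h
    have := h2 b
    rw [← h, h3, sub_eq_iff_eq_add'] at this
    exact this

/-- The evolution operator as a bounded operator. -/
def evolutionOp (hτh : τ ≤ h) : L2 d (-τ) 0 →L[ℝ] L2 d (-τ) 0 :=
  segmentOp d hτh ∘L (Ring.inverse (1 - plusOp hC H2) ∘L minusOp hC H3)

include hC H2 H3 in
theorem exists_unique_isSolution (hτ : 0 < τ) (hh : 0 < h) (hK : 0 ≤ K) (φ : L2 d (-τ) 0) :
    ∃ x : ℝ → E d, IsSolution C τ s (s + h) φ x ∧ ∀ y : ℝ → E d, IsSolution C τ s (s + h) φ y →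
      y =ᵐ[volume.restrict (Icc (s - τ) (s + h))] x := by
  have hU := isUnit_one_sub_plusOp hC H2 hh hK
  have hfix := (eq_plusOp_add_minusOp_iff hC H2 H3 φ _).1 ((eq_inverse_apply hU).2 rfl)
  refine ⟨_, isSolution_of_fixed hfix, fun y hy => ?_⟩
  obtain ⟨w, hw, -, hyw⟩ := hy.exists_fixed hτ
  rw [(eq_inverse_apply hU).1 ((eq_plusOp_add_minusOp_iff hC H2 H3 φ w).2 hw)] at hyw
  exact hyw

/-- The identity is proved against an arbitrary solution, so it applies to whichever one witnesses
the choice in `evolution`. -/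
theorem evolutionOp_apply (hτ : 0 < τ) (hh : 0 < h) (hK : 0 ≤ K) (hτh : τ ≤ h)
    (φ : L2 d (-τ) 0) : evolutionOp hC H2 H3 hτh φ = evolution C τ (s + h) s φ := by
  have hU := isUnit_one_sub_plusOp hC H2 hh hK
  have key : ∀ x, IsSolution C τ s (s + h) φ x →
      evolutionOp hC H2 H3 hτh φ =ᵐ[volume.restrict (Icc (-τ) 0)] fun θ => x (s + h + θ) := by
    intro x hx
    obtain ⟨w, hw, hwx, -⟩ := hx.exists_fixed hτ
    rw [eq_inverse_apply hU |>.1 ((eq_plusOp_add_minusOp_iff hC H2 H3 φ w).2 hw)] at hwx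
    simpa only [add_assoc] using! coeFn_segmentOp hτh hwx
  obtain ⟨x, hx, -⟩ := exists_unique_isSolution hC H2 H3 hτ hh hK φ
  have hspec := Classical.epsilon_spec (p := fun ψ : L2 d (-τ) 0 => ∃ x,
    IsSolution C τ s (s + h) φ x ∧ ∀ᵐ θ ∂(volume.restrict (Icc (-τ) 0)), ψ θ = x (s + h + θ))
    ⟨_, x, hx, key x hx⟩
  obtain ⟨x', hx', hψ⟩ := hspec
  exact Lp.ext ((key x' hx').trans (EventuallyEq.symm hψ))

end InitialValueProblem

/-! ### The discretized evolution operators -/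

section Discretization

variable {d : ℕ} {C : ℝ → ℝ → Matrix (Fin d) (Fin d) ℝ} {τ s h K : ℝ}
  (hC : KernelBound C τ s h K) (H2 : BoundedIntoH1 h (FVplus C τ s h))
  (H3 : BoundedIntoH1 h (FVminus C τ s)) (hh : 0 < h)

/-- The interpolated operator `P_N⁺ R_N⁺ 𝓕 V⁺`. -/
def interpPlusOp (N : ℕ) : L2 d 0 h →L[ℝ] L2 d 0 h := interpOp hh H2 hC.aelinear_FVplus N

/-- The interpolated operator `P_N⁺ R_N⁺ 𝓕 V⁻`. -/
def interpMinusOp (N : ℕ) : L2 d (-τ) 0 →L[ℝ] L2 d 0 h := interpOp hh H3 hC.aelinear_FVminus N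

/-- The splitting of $\mathcal F V$ holds only almost everywhere; it passes to nodal values since
both summands lie in $H^1$ and continuous representatives add. -/
theorem isDiscreteFixedPoint_iff {M N : ℕ} (Φ : Fin (M + 1) → E d) (W : nodes h N → E d) :
    IsDiscreteFixedPoint C τ s h M N Φ W ↔
      W = rplusOp hh H2 hC.aelinear_FVplus N (pplusOp d h N W) +
        rplusOp hh H3 hC.aelinear_FVminus N ((memLp_P τ M Φ).toLp _) := by
  have h1 : F C τ s (V (P τ M Φ) (Pplus h N W)) =ᵐ[volume.restrict (Icc 0 h)]
      FVplus C τ s h (pplusOp d h N W) + FVminus C τ s ((memLp_P τ M Φ).toLp _) := by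
    rw [add_comm]
    exact (F_V_congr (memLp_P τ M Φ).coeFn_toLp.symm (coeFn_pplusOp h N W).symm).trans
      (hC.F_V_split _ _)
  have h2 : Rplus h N (F C τ s (V (P τ M Φ) (Pplus h N W))) =
      rplusOp hh H2 hC.aelinear_FVplus N (pplusOp d h N W) +
        rplusOp hh H3 hC.aelinear_FVminus N ((memLp_P τ M Φ).toLp _) := by
    ext1 x
    rw [Rplus, contRep_congr h1, contRep_add hh (H2.1 _) (H3.1 _)
      (Ioo_subset_Icc_self (nodes_subset hh x.2))]
    rfl
  rw [IsDiscreteFixedPoint, h2]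

include hC H2 H3 in
theorem existsUnique_isDiscreteFixedPoint {N : ℕ} (hN : IsUnit (1 - interpPlusOp hC H2 hh N))
    {M : ℕ} (Φ : Fin (M + 1) → E d) : ∃! W, IsDiscreteFixedPoint C τ s h M N Φ W := by
  set r := rplusOp hh H2 hC.aelinear_FVplus N with hr
  set D : (nodes h N → E d) →ₗ[ℝ] (nodes h N → E d) :=
    LinearMap.id - (r ∘L pplusOp d h N).toLinearMap with hD
  have hDapp : ∀ W, D W = W - r (pplusOp d h N W) := fun W => rfl
  -- A kernel element interpolates to a solution of the homogeneous equation in $L^2$, which is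
  -- zero; its nodal values are then recovered as the image of zero. Injectivity suffices in finite
  -- dimension.
  have hinj : Function.Injective D := by
    rw [injective_iff_map_eq_zero]
    intro W hW
    rw [hDapp, sub_eq_zero] at hW
    have h1 : pplusOp d h N W = interpPlusOp hC H2 hh N (pplusOp d h N W) + 0 := by
      rw [add_zero]
      exact congrArg (pplusOp d h N) hW
    have h2 := (eq_inverse_apply hN).1 h1
    rw [map_zero] at h2
    rw [hW, h2, map_zero]
  have hbij : Function.Bijective D := ⟨hinj, LinearMap.injective_iff_surjective.1 hinj⟩
  refine (existsUnique_congr fun W => ?_).2 (hbij.existsUnique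
    (rplusOp hh H3 hC.aelinear_FVminus N ((memLp_P τ M Φ).toLp _)))
  rw [isDiscreteFixedPoint_iff hC H2 H3 hh, hDapp, sub_eq_iff_eq_add']

theorem R_congr {M : ℕ} {f g : ℝ → E d} (hfg : f =ᵐ[volume.restrict (Icc (-τ) 0)] g) :
    R τ M f = R τ M g := by
  ext1 i
  simp only [R, legendreCoeff]
  congr 1
  exact integral_congr_ae (hfg.mono fun t ht => by simp only [ht])

theorem toLp_P_R (M : ℕ) (φ : L2 d (-τ) 0) :
    (memLp_P τ M (R τ M φ)).toLp _ = projOp d τ M φ :=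
  Lp.ext ((memLp_P τ M (R τ M φ)).coeFn_toLp.trans (coeFn_projOp M φ).symm)

/-- The approximate evolution operator as a bounded operator. -/
def approxOp (hτh : τ ≤ h) (M N : ℕ) : L2 d (-τ) 0 →L[ℝ] L2 d (-τ) 0 :=
  projOp d τ M ∘L (segmentOp d hτh ∘L (Ring.inverse (1 - interpPlusOp hC H2 hh N) ∘L
    (interpMinusOp hC H3 hh N ∘L projOp d τ M)))

theorem approxOp_apply (hτh : τ ≤ h) {N : ℕ} (hN : IsUnit (1 - interpPlusOp hC H2 hh N)) (M : ℕ)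
    (φ : L2 d (-τ) 0) : approxOp hC H2 H3 hh hτh M N φ = approxEvolution C τ s h M N φ := by
  set Φ := R τ M φ with hΦ
  obtain ⟨W, hW⟩ : ∃ W, W = Classical.epsilon fun W => IsDiscreteFixedPoint C τ s h M N Φ W :=
    ⟨_, rfl⟩
  have hfix : IsDiscreteFixedPoint C τ s h M N Φ W := by
    rw [hW]
    exact Classical.epsilon_spec (existsUnique_isDiscreteFixedPoint hC H2 H3 hh hN Φ).exists
  rw [isDiscreteFixedPoint_iff hC H2 H3 hh, hΦ, toLp_P_R] at hfix
  have h1 : pplusOp d h N W = interpPlusOp hC H2 hh N (pplusOp d h N W) +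
      interpMinusOp hC H3 hh N (projOp d τ M φ) := by
    conv_lhs => rw [hfix, map_add]
    rfl
  have h2 := (eq_inverse_apply hN).1 h1
  have h3 : (fun θ => V (P τ M Φ) (Pplus h N W) (h + θ)) =ᵐ[volume.restrict (Icc (-τ) 0)]
      segmentOp d hτh (pplusOp d h N W) := by
    -- When $\tau=h$ the endpoint $\theta=-h$ falls in the branch of `V` given by the initial
    -- function, so that single point is discarded.
    filter_upwards [coeFn_segmentOp hτh (coeFn_pplusOp h N W), ae_restrict_mem measurableSet_Icc,
      ae_restrict_of_ae (Measure.ae_ne volume (-h))] with θ e1 hmem hne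
    have : 0 < h + θ := by
      refine lt_of_le_of_ne (by linarith [hmem.1]) fun h0 => hne (by linarith)
    simp only [V, this, if_true, e1]
  have h4 : approxOp hC H2 H3 hh hτh M N φ =
      projOp d τ M (segmentOp d hτh (pplusOp d h N W)) := by
    rw [h2]; rfl
  rw [h4, ← toLp_P_R, ← R_congr h3, hW]
  rfl

/-- The discrete solution lies in the range of interpolation, so it has degree below $N\le M+1$;
translation preserves this, and the outer projection fixes it. -/
theorem approxOp_eq (hτ : 0 < τ) (hτh : τ ≤ h) {M N : ℕ}
    (hN : IsUnit (1 - interpPlusOp hC H2 hh N)) (hMN : N ≤ M + 1) :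
    approxOp hC H2 H3 hh hτh M N = segmentOp d hτh ∘L
      (Ring.inverse (1 - interpPlusOp hC H2 hh N) ∘L
        (interpMinusOp hC H3 hh N ∘L projOp d τ M)) := by
  ext1 φ
  set w := Ring.inverse (1 - interpPlusOp hC H2 hh N)
    (interpMinusOp hC H3 hh N (projOp d τ M φ)) with hw
  have h1 := (eq_inverse_apply hN).2 hw
  have h2 : ∃ W, w = pplusOp d h N W := by
    refine ⟨rplusOp hh H2 hC.aelinear_FVplus N w +
      rplusOp hh H3 hC.aelinear_FVminus N (projOp d τ M φ), ?_⟩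
    rw [map_add]
    exact h1
  obtain ⟨W, hW⟩ := h2
  change projOp d τ M (segmentOp d hτh w) = segmentOp d hτh w
  refine projOp_of_mem_vpoly hτ (f := fun θ => Pplus h N W (h + θ))
    (comp_add_mem_vpoly (vpoly_mono hMN (Pplus_mem_vpoly hh N W)) h) ?_
  refine coeFn_segmentOp hτh ?_
  rw [hW]
  exact coeFn_pplusOp h N W

theorem tendsto_interpPlusOp :
    Tendsto (fun N => interpPlusOp hC H2 hh N) atTop (𝓝 (plusOp hC H2)) :=
  tendsto_interpOp hh H2 hC.aelinear_FVplus

theorem eventually_isUnit_one_sub_interpPlusOp (hK : 0 ≤ K) :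
    ∀ᶠ N in atTop, IsUnit (1 - interpPlusOp hC H2 hh N) :=
  (tendsto_const_nhds.sub (tendsto_interpPlusOp hC H2 hh)).eventually
    (Units.isOpen.mem_nhds (isUnit_one_sub_plusOp hC H2 hh hK))

theorem tendsto_inverse_one_sub_interpPlusOp (hK : 0 ≤ K) :
    Tendsto (fun N => Ring.inverse (1 - interpPlusOp hC H2 hh N)) atTop
      (𝓝 (Ring.inverse (1 - plusOp hC H2))) := by
  obtain ⟨u, hu⟩ := isUnit_one_sub_plusOp hC H2 hh hK
  have h1 := NormedRing.inverse_continuousAt u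
  rw [hu] at h1
  exact h1.tendsto.comp (tendsto_const_nhds.sub (tendsto_interpPlusOp hC H2 hh))

/-- Contractivity of the projections makes the interpolation error uniform in `M`, so the limit is
joint in both indices. -/
theorem tendsto_interpMinusOp_comp_projOp (hτ : 0 < τ) :
    Tendsto (fun p : ℕ × ℕ => interpMinusOp hC H3 hh p.1 ∘L projOp d τ p.2) (atTop ×ˢ atTop)
      (𝓝 (minusOp hC H3)) := by
  have h1 : Tendsto (fun p : ℕ × ℕ => ‖interpMinusOp hC H3 hh p.1 - minusOp hC H3‖ +
      ‖minusOp hC H3 ∘L projOp d τ p.2 - minusOp hC H3‖) (atTop ×ˢ atTop) (𝓝 0) := by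
    have e1 := tendsto_iff_norm_sub_tendsto_zero.1
      (tendsto_interpOp hh H3 hC.aelinear_FVminus)
    have e2 := tendsto_iff_norm_sub_tendsto_zero.1
      (tendsto_h1Op_comp_projOp hτ hh H3 hC.aelinear_FVminus)
    have := (e1.comp tendsto_fst).add (e2.comp (tendsto_snd (f := (atTop : Filter ℕ))))
    rwa [add_zero] at this
  refine tendsto_iff_norm_sub_tendsto_zero.2 (squeeze_zero (fun _ => norm_nonneg _)
    (fun p => ?_) h1)
  have h2 : interpMinusOp hC H3 hh p.1 ∘L projOp d τ p.2 - minusOp hC H3 =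
      (interpMinusOp hC H3 hh p.1 - minusOp hC H3) ∘L projOp d τ p.2 +
        (minusOp hC H3 ∘L projOp d τ p.2 - minusOp hC H3) := by
    rw [ContinuousLinearMap.sub_comp]; abel
  rw [h2]
  refine (norm_add_le _ _).trans (add_le_add ?_ le_rfl)
  exact (ContinuousLinearMap.opNorm_comp_le _ _).trans
    (mul_le_of_le_one_right (norm_nonneg _) (norm_projOp_le hτ _))

/-- Convergence of the approximate evolution operators in operator norm. -/
theorem exists_norm_approxOp_sub_lt (hτ : 0 < τ) (hτh : τ ≤ h) (hK : 0 ≤ K) {ε : ℝ} (hε : 0 < ε) :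
    ∃ N₀ : ℕ, ∀ N ≥ N₀, ∀ M : ℕ, N ≤ M + 1 →
      ‖approxOp hC H2 H3 hh hτh M N - evolutionOp hC H2 H3 hτh‖ < ε := by
  have h1 : Tendsto (fun p : ℕ × ℕ => segmentOp d hτh ∘L
      (Ring.inverse (1 - interpPlusOp hC H2 hh p.1) ∘L
        (interpMinusOp hC H3 hh p.1 ∘L projOp d τ p.2))) (atTop ×ˢ atTop)
      (𝓝 (evolutionOp hC H2 H3 hτh)) := by
    have h2 := ((tendsto_inverse_one_sub_interpPlusOp hC H2 hh hK).comp
      (tendsto_fst (g := (atTop : Filter ℕ)))).prodMk_nhds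
      (tendsto_interpMinusOp_comp_projOp hC H3 hh hτ)
    exact ((continuous_const.clm_comp (continuous_fst.clm_comp continuous_snd)).tendsto _).comp h2
  have h3 := (Metric.tendsto_nhds.1 h1 ε hε)
  rw [prod_atTop_atTop_eq, eventually_atTop] at h3
  obtain ⟨⟨N₁, M₁⟩, h4⟩ := h3
  obtain ⟨N₂, h5⟩ := eventually_atTop.1 (eventually_isUnit_one_sub_interpPlusOp hC H2 hh hK)
  -- The term `M₁ + 1` turns $N\le M+1$ into $M\ge M_1$, so largeness of `N` alone suffices.
  refine ⟨max (max N₁ N₂) (M₁ + 1), fun N hN M hMN => ?_⟩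
  simp only [ge_iff_le, max_le_iff] at hN
  have h6 := h4 (N, M) ⟨hN.1.1, by omega⟩
  rw [dist_eq_norm] at h6
  rw [approxOp_eq hC H2 H3 hh hτ hτh (h5 N hN.1.2) hMN]
  exact h6

end Discretization

end RenewalEq

end

/-! ### The convergence theorem -/

theorem mainTheorem1 (d : ℕ) (hd : 0 < d) (τ s h : ℝ) (hτ : 0 < τ) (hh : τ ≤ h)
    (C : ℝ → ℝ → Matrix (Fin d) (Fin d) ℝ)
    (H1 : RenewalEq.KernelLInfty C τ s (s + h))
    (H2 : RenewalEq.BoundedIntoH1 h (RenewalEq.FVplus C τ s h))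
    (H3 : RenewalEq.BoundedIntoH1 h (RenewalEq.FVminus C τ s)) :
    -- the initial value problem has a unique solution, so that the evolution operator is defined
    (∀ φ : RenewalEq.L2 d (-τ) 0, ∃ x : ℝ → RenewalEq.E d, RenewalEq.IsSolution C τ s (s + h) φ x ∧
      ∀ y : ℝ → RenewalEq.E d, RenewalEq.IsSolution C τ s (s + h) φ y →
        y =ᵐ[volume.restrict (Icc (s - τ) (s + h))] x) ∧
    -- eventually the discrete fixed point equation is uniquely solvable
    (∃ N₀ : ℕ, ∀ N ≥ N₀, ∀ M : ℕ, ∀ Φ : Fin (M + 1) → RenewalEq.E d,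
      ∃! W, RenewalEq.IsDiscreteFixedPoint C τ s h M N Φ W) ∧
    -- the operators are linear and bounded, and the approximations converge in operator norm
    (∃ T : RenewalEq.L2 d (-τ) 0 →L[ℝ] RenewalEq.L2 d (-τ) 0,
      (∀ φ, T φ = RenewalEq.evolution C τ (s + h) s φ) ∧
      ∃ TMN : ℕ → ℕ → RenewalEq.L2 d (-τ) 0 →L[ℝ] RenewalEq.L2 d (-τ) 0,
        (∃ N₀ : ℕ, ∀ N ≥ N₀, ∀ M : ℕ, ∀ φ,
          TMN M N φ = RenewalEq.approxEvolution C τ s h M N φ) ∧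
        ∀ ε : ℝ, 0 < ε → ∃ N₀ : ℕ, ∀ N ≥ N₀, ∀ M : ℕ, N ≤ M + 1 → ‖TMN M N - T‖ < ε) := by
  have h0 : 0 < h := hτ.trans_le hh
  obtain ⟨K, hK, hC⟩ := RenewalEq.exists_kernelBound H1
  obtain ⟨N₀, hN₀⟩ := eventually_atTop.1
    (RenewalEq.eventually_isUnit_one_sub_interpPlusOp hC H2 h0 hK)
  refine ⟨RenewalEq.exists_unique_isSolution hC H2 H3 hτ h0 hK,
    ⟨N₀, fun N hN M Φ => RenewalEq.existsUnique_isDiscreteFixedPoint hC H2 H3 h0 (hN₀ N hN) Φ⟩,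
    RenewalEq.evolutionOp hC H2 H3 hh, RenewalEq.evolutionOp_apply hC H2 H3 hτ h0 hK hh,
    -- Defined for all indices, because `Ring.inverse` is zero off the units; agreement with the
    -- discretisation is asserted only from `N₀` on.
    RenewalEq.approxOp hC H2 H3 h0 hh,
    ⟨N₀, fun N hN M φ => RenewalEq.approxOp_apply hC H2 H3 h0 hh (hN₀ N hN) M φ⟩,
    fun ε hε => RenewalEq.exists_norm_approxOp_sub_lt hC H2 H3 h0 hτ hh hK hε⟩
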